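/- Notation. Let $m>0$ and let $T=T(-i\nabla)$ be one of the operators with symbol $T_S(\mathbf p)=|\mathbf p|^2$ (Schrödinger), $T_{\psi rel}(\mathbf p)=\sqrt{|\mathbf p|^2+m^2}-m$ (pseudorelativistic), both in $L_2(\mathbb R^3;\mathbb C)$, or $T_D(\mathbf p)=\boldsymbol\alpha\cdot\mathbf p+m\beta-m$ (Dirac) in $L_2(\mathbb R^3;\mathbb C^4)$, where $\boldsymbol\alpha,\beta$ are the Dirac matrices in the standard representation. In the first two cases $V\ge 0$ is a scalar function and $I=(-\infty,0)$; in the Dirac case $V=\mathrm{diag}(V_1,\dots,V_4)$ with $V_i\ge0$ and $I=(-2m,0)$. The eigenvalue equation $(T-\lambda V)\varphi=E\varphi$ is understood in the sense of quadratic forms: $|T|^{1/2}\varphi,V^{1/2}\varphi\in L_2$ and $\langle\psi,T\varphi\rangle-\lambda\langle V^{1/2}\psi,V^{1/2}\varphi\rangle=E\langle\psi,\varphi\rangle$ for all $\psi\in L_2$ with $|T|^{1/2}\psi,V^{1/2}\psi\in L_2$. **Lemma.** Let $0<\epsilon<3/2$ and assume that - $V\in L_{3/2+\epsilon}(\mathbb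 R^3)\cap L_{3/2-\epsilon}(\mathbb R^3)$ in the Schrödinger case, - $V\in L_{3+\epsilon}(\mathbb R^3)\cap L_{3/2-\epsilon}(\mathbb R^3)$ in the pseudorelativistic case, - $V\in L_{3+\epsilon}(\mathbb R^3)\cap L_{3/2-\epsilon}(\mathbb R^3)$ (for every entry) in the Dirac case. Then: (i) For every $E\in I$ the closure $K_E$ of the product $V^{1/2}(T-E)^{-1}V^{1/2}$ (the Birman–Schwinger operator) is an everywhere defined bounded operator on $L_2$, and it is compact. (ii) The operator-norm limit $K_0=\lim_{E\uparrow0}K_E$ exists; in the Dirac case the operator-norm limit $K_{-2m}=\lim_{E\downarrow-2m}K_E$ exists as well. (iii) $K_0$ (and, in the Dirac case, $K_{-2m}$) is compact. (iv) Let $E_*=0$ (or $E_*=-2m$ in the Dirac case), let $E_n\in I$ with $E_n\to E_*$, let $\lambda_n\in\mathbb R$ with $\lambda_n\to\lambda_c\in\mathbb R$ (in particular, $\lambda_c$ may be a coupling constant threshold, with $\lambda_n\downarrow\lambda_c$ as $E_n\uparrow0$, or $\lambda_n\uparrow\lambda_c$ as $E_n\downarrow-2m$), and let $\varphi_n\in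 L_2$ with $\|\varphi_n\|_2=1$ and $(T-\lambda_nV)\varphi_n=E_n\varphi_n$. Put $\mu_n=V^{1/2}\varphi_n\in L_2$. Then $\lambda_c\neq0$, and there are a subsequence $(\mu_{n_k})_k$ and $\mu_*\in L_2$ such that $\mu_{n_k}\to\mu_*$ in $L_2$ as $k\to\infty$ and $K_{E_*}\mu_*=\lambda_c^{-1}\mu_*$. -/

import Mathlib

open MeasureTheory Filter Topology

noncomputable section

/-- Three-dimensional Euclidean space. -/
abbrev R3 : Type := EuclideanSpace ℝ (Fin 3)

/-- The Hilbert space `L₂(ℝ³; F)`; here `F` is `ℂ` or `ℂ⁴`. -/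
abbrev L2 (F : Type) [NormedAddCommGroup F] : Type := Lp F 2 (volume : Measure R3)

section General

variable {F : Type} [NormedAddCommGroup F] [InnerProductSpace ℂ F] [CompleteSpace F]

/-- The unitary Fourier transform of `φ` in the normalization `∫ e^{-2πi x·ξ} φ(x) dx`.
The momentum variable of the transform with kernel `e^{-i p·x}` is `p = 2π ξ`. -/
def fourierL2 (φ : L2 F) : L2 F := Lp.fourierTransformₗᵢ R3 F φ

/-- The value at `ξ` of the symbol `t = t(p)` of `T = t(-i∇)`, expressed in the variable
`ξ = p / (2π)`. -/
def symbolAt (t : R3 → F →L[ℂ] F) (ξ : R3) : F →L[ℂ] F := t ((2 * Real.pi) • ξ)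

/-- `v = A u`: the function `u ∈ L₂` lies in the (maximal) domain of the operator of multiplication
by the operator-valued function `A`, and is mapped to `v ∈ L₂`. -/
def IsMul (A : R3 → F →L[ℂ] F) (u v : L2 F) : Prop :=
  ∀ᵐ x ∂(volume : Measure R3), v x = A x (u x)

/-- `v = t(-i∇) φ`: the function `φ ∈ L₂` lies in the (maximal) domain of the Fourier multiplier
with symbol `t`, and is mapped to `v ∈ L₂`. -/
def IsKinetic (t : R3 → F →L[ℂ] F) (φ v : L2 F) : Prop :=
  IsMul (symbolAt t) (fourierL2 φ) (fourierL2 v)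

/-- The graph of the product of unbounded operators `W (T - E)⁻¹ W` on its natural domain, where
`T = t(-i∇)` and `W` is multiplication by `W = V^{1/2}`: the pairs `(u, w)` such that
`f = W u ∈ L₂`, `(T - E) φ = f` and `w = W φ ∈ L₂`. -/
def birmanSchwingerGraph (t W : R3 → F →L[ℂ] F) (E : ℝ) : Set (L2 F × L2 F) :=
  {q | ∃ f φ : L2 F, IsMul W q.1 f ∧ IsKinetic t φ (f + (E : ℂ) • φ) ∧ IsMul W φ q.2}

/-- `K` is the Birman-Schwinger operator `V^{1/2} (T - E)⁻¹ V^{1/2}` as an everywhere defined bounded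
operator: its graph is the closure of the graph of the product of the three operators.
(This determines `K`, and contains the fact that the product is densely defined.) -/
def IsBirmanSchwinger (t W : R3 → F →L[ℂ] F) (E : ℝ) (K : L2 F →L[ℂ] L2 F) : Prop :=
  closure (birmanSchwingerGraph t W E) = {q | q.2 = K q.1}

/-- The common form domain of `T = t(-i∇)` and `V = W²`: the functions `φ ∈ L₂` such that
`|T|^{1/2} φ ∈ L₂` and `V^{1/2} φ ∈ L₂`. -/
def InFormDomain (t W : R3 → F →L[ℂ] F) (φ : L2 F) : Prop :=
  Integrable (fun ξ => ‖symbolAt t ξ‖ * ‖fourierL2 φ ξ‖ ^ 2) (volume : Measure R3) ∧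
    MemLp (fun x => W x (φ x)) 2 (volume : Measure R3)

/-- The eigenvalue equation `(T - lam V) φ = E φ` for the operator `T - lam V`, `V = W²`, defined
as the sum of quadratic forms: `φ` is in the form domain and
`⟨ψ, T φ⟩ - lam ⟨V^{1/2} ψ, V^{1/2} φ⟩ = E ⟨ψ, φ⟩` for all `ψ` in the form domain. -/
def SolvesEigenEq (t W : R3 → F →L[ℂ] F) (lam E : ℝ) (φ : L2 F) : Prop :=
  InFormDomain t W φ ∧ ∀ ψ : L2 F, InFormDomain t W ψ →
    (∫ ξ : R3, inner ℂ (fourierL2 ψ ξ) (symbolAt t ξ (fourierL2 φ ξ)))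
      - (lam : ℂ) * (∫ x : R3, inner ℂ (W x (ψ x)) (W x (φ x))) = (E : ℂ) * inner ℂ ψ φ

/-- Normalized eigenfunctions `φ n` of `T - lam n V`, with eigenvalues `E n` in the set `I` (a gap of
the spectrum of `T`) converging to the threshold `E₀` while the couplings `lam n` converge to `lamc`,
together with the Birman-Schwinger eigenfunctions `μ n = V^{1/2} φ n`. -/
structure IsThresholdSequence (t W : R3 → F →L[ℂ] F) (I : Set ℝ) (E₀ lamc : ℝ)
    (lam E : ℕ → ℝ) (φ μ : ℕ → L2 F) : Prop where
  energy_mem : ∀ n, E n ∈ I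
  energy_tendsto : Tendsto E atTop (𝓝 E₀)
  coupling_tendsto : Tendsto lam atTop (𝓝 lamc)
  normalized : ∀ n, ‖φ n‖ = 1
  eigen : ∀ n, SolvesEigenEq t W (lam n) (E n) (φ n)
  birmanSchwinger : ∀ n, IsMul W (φ n) (μ n)

/-- Along a subsequence the Birman-Schwinger eigenfunctions of every threshold sequence converge in
`L₂` to some `μ₀` with `K₀ μ₀ = lamc⁻¹ μ₀` (where `lamc ≠ 0`). -/
def EigenfunctionsConverge (t W : R3 → F →L[ℂ] F) (I : Set ℝ) (E₀ : ℝ)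
    (K₀ : L2 F →L[ℂ] L2 F) : Prop :=
  ∀ (lamc : ℝ) (lam E : ℕ → ℝ) (φ μ : ℕ → L2 F),
    IsThresholdSequence t W I E₀ lamc lam E φ μ →
      lamc ≠ 0 ∧ ∃ (k : ℕ → ℕ) (μ₀ : L2 F), StrictMono k ∧
        Tendsto (fun j => μ (k j)) atTop (𝓝 μ₀) ∧ K₀ μ₀ = ((lamc⁻¹ : ℝ) : ℂ) • μ₀

end General

/-- Symbol of the Schrödinger kinetic energy `-Δ`: `p²`. -/
def schroedingerSymbol (p : R3) : ℂ →L[ℂ] ℂ :=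
  ((‖p‖ ^ 2 : ℝ) : ℂ) • ContinuousLinearMap.id ℂ ℂ

/-- Symbol of the pseudorelativistic kinetic energy `√(-Δ + m²) - m`. -/
def pseudorelSymbol (m : ℝ) (p : R3) : ℂ →L[ℂ] ℂ :=
  ((Real.sqrt (‖p‖ ^ 2 + m ^ 2) - m : ℝ) : ℂ) • ContinuousLinearMap.id ℂ ℂ

/-- Multiplication by `V^{1/2}` for a scalar potential `V ≥ 0`. -/
def scalarSqrt (V : R3 → ℝ) (x : R3) : ℂ →L[ℂ] ℂ :=
  ((Real.sqrt (V x) : ℝ) : ℂ) • ContinuousLinearMap.id ℂ ℂ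

/-- The spinor space `ℂ⁴` with its Euclidean norm. -/
abbrev C4 : Type := EuclideanSpace ℂ (Fin 4)

/-- The Dirac matrices `α₁, α₂, α₃` (in the standard representation). -/
def diracAlpha : Fin 3 → Matrix (Fin 4) (Fin 4) ℂ :=
  ![!![0, 0, 0, 1; 0, 0, 1, 0; 0, 1, 0, 0; 1, 0, 0, 0],
    !![0, 0, 0, -Complex.I; 0, 0, Complex.I, 0; 0, -Complex.I, 0, 0; Complex.I, 0, 0, 0],
    !![0, 0, 1, 0; 0, 0, 0, -1; 1, 0, 0, 0; 0, -1, 0, 0]]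

/-- The Dirac matrix `β = diag(1, 1, -1, -1)`. -/
def diracBeta : Matrix (Fin 4) (Fin 4) ℂ := Matrix.diagonal ![1, 1, -1, -1]

/-- Symbol of the Dirac operator `α·(-i∇) + mβ - m`. -/
def diracSymbol (m : ℝ) (p : R3) : C4 →L[ℂ] C4 :=
  Matrix.toEuclideanCLM (𝕜 := ℂ) (n := Fin 4)
    ((∑ j, ((p j : ℝ) : ℂ) • diracAlpha j) + (m : ℂ) • diracBeta - (m : ℂ) • 1)

/-- Multiplication by `V^{1/2}` for a diagonal matrix potential `V = diag(V₁, …, V₄)`, `Vᵢ ≥ 0`. -/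
def diagonalSqrt (V : R3 → EuclideanSpace ℝ (Fin 4)) (x : R3) : C4 →L[ℂ] C4 :=
  Matrix.toEuclideanCLM (𝕜 := ℂ) (n := Fin 4)
    (Matrix.diagonal fun i => ((Real.sqrt (V x i) : ℝ) : ℂ))

end

/-!
Let `W = V^{1/2}` and let `g(ξ)` be the momentum weight that equals `|ξ|⁻¹` for `|ξ| < 1` and
`|ξ|^{-b}` for `|ξ| ≥ 1`, with `b = 1` in the Schrödinger case and `b = 1/2` in the two relativistic
ones. The proof rests on the factorization
`K_E = A M_E A^*`, `A = W g(-i∇)`, `M_E = g(-i∇)⁻² (T - E)⁻¹`.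

* The operator `A` is compact (`exists_isProd_weight`). On a momentum shell `|ξ| ~ ρ` one splits `W`
  at a height `τ`: the part above `τ` is square integrable and gives a Hilbert-Schmidt operator
  (`exists_isProd_of_memLp_two`), the part below is bounded by `τ`. Letting `τ → 0` shows compactness
  on the shell, and `τ = ρ^{3/p}`, for `W ∈ L_p`, bounds the norm by `C (sup g) ρ^{3/p}`
  (`exists_isProd_shell`). The dyadic sum over the shells converges in norm because `W ∈ L_p` for
  some `p < 3`, used for `ρ → 0`, and for some `p > 3 / b`, used for `ρ → ∞`.
* The symbol of `M_E` is bounded uniformly in `E` and converges pointwise as `E` tends to a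
  threshold, since `g²` dominates `(T - E)⁻¹` up to and including the threshold
  (`IsResolventFamily`, verified for the three operators at the end). Hence `M_E` converges
  strongly, and as `A^*` is compact, `M_E A^*` and therefore `K_E` converge in norm (`tendsto_bsOp`).
  All `K_E`, those at the thresholds included, are compact because `A` is.
* If `(T - λV)φ = Eφ` and `μ = W φ`, testing with functions of momenta in an annulus gives
  `φ = g M_E A^* (λμ)` and hence `μ = λ K_E μ` (`SolvesEigenEq.fourier_eq`, `SolvesEigenEq.bsOp_eq`).
  Moreover `‖μ‖ ≤ D ‖φ‖` with `D` independent of `E` (`exists_norm_le_of_solvesEigenEq`): on an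
  annulus `g⁻¹` is bounded, and outside a large annulus `A^*` is small in norm, so that this
  contribution to `μ` can be absorbed. So the `μ_n` are bounded and nonzero, which excludes
  `λ_n → 0`, and the compactness of `K_{E_*}` gives a convergent subsequence whose limit satisfies
  the limiting equation (`eigenfunctionsConverge_bsOp`).
-/

noncomputable section

/-! ### Compact operators -/

section Abstract

/-- Schauder's theorem for Hilbert spaces. If `A A^*` maps the unit ball to a totally bounded set, so
does `A^*`, since `‖A^* v‖² ≤ ‖A A^* v‖ ‖v‖`. -/
theorem IsCompactOperator.hilbert_adjoint {H₁ H₂ : Type*} [NormedAddCommGroup H₁]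
    [InnerProductSpace ℂ H₁] [CompleteSpace H₁] [NormedAddCommGroup H₂] [InnerProductSpace ℂ H₂]
    [CompleteSpace H₂] {A : H₁ →L[ℂ] H₂} (hA : IsCompactOperator A) :
    IsCompactOperator (ContinuousLinearMap.adjoint A) := by
  set B := ContinuousLinearMap.adjoint A with hB
  have hAB : IsCompactOperator (A ∘L B) := hA.comp_clm B
  change IsCompactOperator (B : H₂ →ₗ[ℂ] H₁)
  rw [isCompactOperator_iff_isCompact_closure_image_closedBall (B : H₂ →ₗ[ℂ] H₁) zero_lt_one]
  suffices h : TotallyBounded (B '' Metric.closedBall 0 1) from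
    h.closure.isCompact_of_isClosed isClosed_closure
  have hT : TotallyBounded ((A ∘L B) '' Metric.closedBall 0 1) :=
    (hAB.isCompact_closure_image_closedBall (f := ((A ∘L B : H₂ →L[ℂ] H₂) : H₂ →ₗ[ℂ] H₂)) 1
      ).totallyBounded.subset subset_closure
  rw [Metric.totallyBounded_iff]
  intro ε hε
  obtain ⟨t, ht, htf, hcov⟩ := (totallyBounded_iff_subset.1 hT)
    {p | dist p.1 p.2 < ε ^ 2 / 4} (Metric.dist_mem_uniformity (by positivity))
  choose! s hs hst using fun y (hy : y ∈ t) => ht hy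
  refine ⟨(fun y => B (s y)) '' t, htf.image _, ?_⟩
  rintro _ ⟨u, hu, rfl⟩
  obtain ⟨y, hy, hyu⟩ := Set.mem_iUnion₂.1 (hcov ⟨u, hu, rfl⟩)
  refine Set.mem_iUnion₂.2 ⟨B (s y), ⟨y, hy, rfl⟩, ?_⟩
  rw [Metric.mem_ball, dist_eq_norm, ← map_sub]
  have hsy := hs y hy
  rw [mem_closedBall_zero_iff] at hu hsy
  have h1 : ‖A (B (u - s y))‖ < ε ^ 2 / 4 := by
    have h2 := hst y hy
    simp only [ContinuousLinearMap.comp_apply] at h2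
    rw [map_sub, map_sub, h2, ← dist_eq_norm]
    exact hyu
  have h3 : ‖B (u - s y)‖ ^ 2 ≤ ‖A (B (u - s y))‖ * ‖u - s y‖ := by
    have : inner ℂ (B (u - s y)) (B (u - s y)) = inner ℂ (A (B (u - s y))) (u - s y) := by
      rw [hB, ContinuousLinearMap.adjoint_inner_right]
    have h5 : ‖B (u - s y)‖ ^ 2 = ‖inner ℂ (B (u - s y)) (B (u - s y))‖ := by
      rw [inner_self_eq_norm_sq_to_K]; simp
    rw [h5, this]
    exact norm_inner_le_norm _ _
  have h4 : ‖u - s y‖ ≤ 2 := (norm_sub_le _ _).trans (by linarith)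
  refine lt_of_pow_lt_pow_left₀ 2 hε.le ?_
  have := mul_le_mul h1.le h4 (norm_nonneg _) (by positivity)
  nlinarith [sq_pos_of_pos hε]

/-- A bounded strongly convergent family of operators converges in norm after composition with a
compact operator on the right, since strong convergence is uniform on compact sets. -/
theorem tendsto_comp_of_isCompactOperator {ι H₁ H₂ H₃ : Type*} [NormedAddCommGroup H₁]
    [NormedSpace ℂ H₁] [NormedAddCommGroup H₂] [NormedSpace ℂ H₂] [NormedAddCommGroup H₃]
    [NormedSpace ℂ H₃] {l : Filter ι} {X : ι → H₂ →L[ℂ] H₃} {Y : H₂ →L[ℂ] H₃} {C : ℝ}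
    (hC : ∀ᶠ i in l, ‖X i‖ ≤ C) (hX : ∀ v, Tendsto (fun i => X i v) l (𝓝 (Y v)))
    {K : H₁ →L[ℂ] H₂} (hK : IsCompactOperator K) :
    Tendsto (fun i => X i ∘L K) l (𝓝 (Y ∘L K)) := by
  have hT : TotallyBounded (K '' Metric.closedBall 0 1) :=
    (hK.isCompact_closure_image_closedBall (f := (K : H₁ →ₗ[ℂ] H₂)) 1
      ).totallyBounded.subset subset_closure
  rw [Metric.totallyBounded_iff] at hT
  rw [Metric.tendsto_nhds]
  intro ε hε
  set D := |C| + ‖Y‖ + 1 with hD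
  have hDpos : 0 < D := by positivity
  obtain ⟨t, htf, hcov⟩ := hT (ε / (4 * D)) (by positivity)
  have hev : ∀ᶠ i in l, ∀ y ∈ t, dist (X i y) (Y y) < ε / 4 := by
    rw [eventually_all_finite htf]
    exact fun y _ => (Metric.tendsto_nhds.1 (hX y)) _ (by positivity)
  filter_upwards [hC, hev] with i hi hti
  rw [dist_eq_norm]
  refine lt_of_le_of_lt (ContinuousLinearMap.opNorm_le_of_unit_norm (C := ε / 2) (by positivity)
    fun u hu => ?_) (by linarith)
  have hu' : u ∈ Metric.closedBall (0 : H₁) 1 := by simp [hu]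
  obtain ⟨y, hy, hyu⟩ := Set.mem_iUnion₂.1 (hcov ⟨u, hu', rfl⟩)
  rw [Metric.mem_ball, dist_eq_norm] at hyu
  have e : (X i ∘L K - Y ∘L K) u = (X i - Y) (K u - y) + (X i y - Y y) := by
    simp only [sub_apply, ContinuousLinearMap.comp_apply, map_sub]
    abel
  rw [e]
  have h1 : ‖(X i - Y) (K u - y)‖ ≤ D * (ε / (4 * D)) := by
    refine (ContinuousLinearMap.le_opNorm _ _).trans ?_
    gcongr
    refine (norm_sub_le _ _).trans ?_
    linarith [le_abs_self C]
  have h2 : D * (ε / (4 * D)) = ε / 4 := by field_simp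
  have h3 := hti y hy
  rw [dist_eq_norm] at h3
  linarith [norm_add_le ((X i - Y) (K u - y)) (X i y - Y y)]

variable {X : Type*} [MeasurableSpace X] {ν : Measure X} {H F : Type*}
  [NormedAddCommGroup H] [NormedSpace ℂ H] [NormedAddCommGroup F] [NormedSpace ℂ F]

variable (ν H F) in
/-- The operator `φ ↦ (x ↦ k x φ)` with an operator valued square integrable kernel `k`. -/
def kernelOp : Lp (H →L[ℂ] F) 2 ν →L[ℂ] H →L[ℂ] Lp F 2 ν :=
  LinearMap.mkContinuous₂
    (LinearMap.mk₂ ℂ (fun k φ => (ContinuousLinearMap.apply ℂ F φ).compLp k)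
      (fun k₁ k₂ φ => ((ContinuousLinearMap.apply ℂ F φ).compLpₗ 2 ν).map_add k₁ k₂)
      (fun c k φ => ((ContinuousLinearMap.apply ℂ F φ).compLpₗ 2 ν).map_smul c k)
      (fun k φ₁ φ₂ => by rw [map_add, ContinuousLinearMap.add_compLp])
      (fun c k φ => by rw [map_smul, ContinuousLinearMap.smul_compLp])) 1 (fun k φ => by
        refine (ContinuousLinearMap.norm_compLp_le _ _).trans ?_
        rw [one_mul, mul_comm]
        gcongr
        exact ContinuousLinearMap.opNorm_le_bound _ (norm_nonneg _) fun T => by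
          rw [mul_comm]; exact T.le_opNorm φ)

theorem coeFn_kernelOp (k : Lp (H →L[ℂ] F) 2 ν) (φ : H) :
    kernelOp ν H F k φ =ᵐ[ν] fun x => k x φ :=
  ContinuousLinearMap.coeFn_compLp' _ _

theorem norm_kernelOp_apply_le (k : Lp (H →L[ℂ] F) 2 ν) : ‖kernelOp ν H F k‖ ≤ ‖k‖ := by
  refine (ContinuousLinearMap.le_opNorm _ _).trans ?_
  have : ‖kernelOp ν H F‖ ≤ 1 := LinearMap.mkContinuous₂_norm_le _ zero_le_one _
  nlinarith [norm_nonneg k]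

/-- Operators with square integrable kernels are compact: simple kernels give finite rank
operators, and these are dense. -/
theorem isCompactOperator_kernelOp [FiniteDimensional ℂ F] (k : Lp (H →L[ℂ] F) 2 ν) :
    IsCompactOperator (kernelOp ν H F k) := by
  have : CompleteSpace F := FiniteDimensional.complete ℂ F
  have : ProperSpace F := FiniteDimensional.proper ℂ F
  refine Lp.induction (by simp) (motive := fun k => IsCompactOperator (kernelOp ν H F k))
    ?_ ?_ ?_ k
  · intro c s hs hμs
    have hc : IsCompactOperator c := (isCompactOperator_id (E := F)).comp_clm c
    -- the operator of rank at most `dim F` given by `1_s c` factors through `c`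
    have : (kernelOp ν H F (Lp.simpleFunc.indicatorConst 2 hs hμs.ne c)) =
        (kernelOp ν F F (indicatorConstLp 2 hs hμs.ne (ContinuousLinearMap.id ℂ F))) ∘L c := by
      ext1 φ
      rw [Lp.simpleFunc.coe_indicatorConst]
      refine Lp.ext ?_
      filter_upwards [coeFn_kernelOp (indicatorConstLp 2 hs hμs.ne c) φ,
        coeFn_kernelOp (indicatorConstLp 2 hs hμs.ne (ContinuousLinearMap.id ℂ F)) (c φ),
        indicatorConstLp_coeFn (p := 2) (hs := hs) (hμs := hμs.ne) (c := c),
        indicatorConstLp_coeFn (p := 2) (hs := hs) (hμs := hμs.ne)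
          (c := ContinuousLinearMap.id ℂ F)] with x h1 h2 h3 h4
      rw [ContinuousLinearMap.comp_apply, h1, h2, h3, h4]
      by_cases hx : x ∈ s <;> simp [hx]
    rw [this]
    exact hc.clm_comp
      (kernelOp ν F F (indicatorConstLp 2 hs hμs.ne (ContinuousLinearMap.id ℂ F)))
  · intro f g hf hg _ h1 h2
    rw [map_add]
    exact h1.add h2
  · exact isClosed_setOfPred_isCompactOperator.preimage (kernelOp ν H F).continuous

/-- A square integrable weight times a bounded continuous family of finite rank maps is the kernel
of a compact operator. -/
theorem exists_isCompactOperator_kernel [FiniteDimensional ℂ F] [TopologicalSpace X]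
    [OpensMeasurableSpace X] [SecondCountableTopology X] {W : X → F →L[ℂ] F} (hW : MemLp W 2 ν)
    {e : X → H →L[ℂ] F} (he : Continuous e) {c : ℝ} (hc : ∀ x, ‖e x‖ ≤ c) (hc0 : 0 ≤ c) :
    ∃ T : H →L[ℂ] Lp F 2 ν, IsCompactOperator T ∧ (∀ φ, T φ =ᵐ[ν] fun x => W x (e x φ)) ∧
      ‖T‖ ≤ c * (eLpNorm W 2 ν).toReal := by
  set k : X → H →L[ℂ] F := fun x => W x ∘L e x with hk
  have hkm : AEStronglyMeasurable k ν :=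
    (ContinuousLinearMap.compL ℂ H F F).aestronglyMeasurable_comp₂ hW.1 he.aestronglyMeasurable
  have hkb : ∀ᵐ x ∂ν, ‖k x‖ ≤ c * ‖W x‖ := Eventually.of_forall fun x => by
    refine (ContinuousLinearMap.opNorm_comp_le _ _).trans ?_
    rw [mul_comm]
    gcongr
    exact hc x
  have hkL : MemLp k 2 ν := hW.of_le_mul hkm hkb
  refine ⟨kernelOp ν H F (hkL.toLp k), isCompactOperator_kernelOp _, fun φ => ?_, ?_⟩
  · filter_upwards [coeFn_kernelOp (hkL.toLp k) φ, hkL.coeFn_toLp] with x h4 h5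
    rw [h4, h5]
    rfl
  · refine (norm_kernelOp_apply_le _).trans ?_
    rw [Lp.norm_toLp]
    refine (ENNReal.toReal_mono ?_ (eLpNorm_le_mul_eLpNorm_of_ae_le_mul hkb 2)).trans ?_
    · exact ENNReal.mul_ne_top ENNReal.ofReal_ne_top hW.2.ne
    · rw [ENNReal.toReal_mul, ENNReal.toReal_ofReal hc0]

end Abstract

/-! ### Multiplication operators, Fourier multipliers and the Hilbert-Schmidt criterion -/

section Multipliers

open FourierTransform

variable {F : Type} [NormedAddCommGroup F] [InnerProductSpace ℂ F]

/-- Multiplication by an operator valued function whose norm is bounded by `C`. -/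
def mulOp (M : R3 → F →L[ℂ] F) (C : ℝ) (hM : AEStronglyMeasurable M volume)
    (hC : ∀ᵐ x ∂(volume : Measure R3), ‖M x‖ ≤ C) : L2 F →L[ℂ] L2 F :=
  ContinuousLinearMap.holderL volume ⊤ 2 2 (ContinuousLinearMap.id ℂ (F →L[ℂ] F))
    ((memLp_top_of_bound hM C hC).toLp M)

theorem isMul_mulOp {M : R3 → F →L[ℂ] F} {C : ℝ} (hM : AEStronglyMeasurable M volume)
    (hC : ∀ᵐ x ∂(volume : Measure R3), ‖M x‖ ≤ C) (u : L2 F) : IsMul M u (mulOp M C hM hC u) := by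
  filter_upwards [ContinuousLinearMap.coeFn_holder (r := 2) (ContinuousLinearMap.id ℂ (F →L[ℂ] F))
    ((memLp_top_of_bound hM C hC).toLp M) u, (memLp_top_of_bound hM C hC).coeFn_toLp] with x h1 h2
  rw [mulOp, ContinuousLinearMap.holderL_apply_apply, h1, h2]
  rfl

theorem IsMul.unique {M : R3 → F →L[ℂ] F} {u v w : L2 F} (h1 : IsMul M u v) (h2 : IsMul M u w) :
    v = w := by
  refine Lp.ext ?_
  filter_upwards [h1, h2] with x h1 h2
  rw [h1, h2]

theorem IsMul.norm_le {M : R3 → F →L[ℂ] F} {C : ℝ}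
    (hC : ∀ᵐ x ∂(volume : Measure R3), ‖M x‖ ≤ C) {u v : L2 F} (h : IsMul M u v) :
    ‖v‖ ≤ C * ‖u‖ := by
  refine Lp.norm_le_mul_norm_of_ae_le_mul ?_
  filter_upwards [hC, h] with x h1 h2
  rw [h2]
  exact (M x).le_of_opNorm_le h1 _

/-- Multiplication operators are closed. -/
theorem IsMul.of_tendsto {ι : Type*} {l : Filter ι} [l.NeBot] [l.IsCountablyGenerated]
    {M : R3 → F →L[ℂ] F} {u v : ι → L2 F} {u₀ v₀ : L2 F}
    (h : ∀ i, IsMul M (u i) (v i)) (hu : Tendsto u l (𝓝 u₀)) (hv : Tendsto v l (𝓝 v₀)) :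
    IsMul M u₀ v₀ := by
  obtain ⟨s, hs⟩ := l.exists_seq_tendsto
  obtain ⟨s₁, hs₁, h1⟩ := (tendstoInMeasure_of_tendsto_Lp (hu.comp hs)).exists_seq_tendsto_ae
  obtain ⟨s₂, hs₂, h2⟩ := (tendstoInMeasure_of_tendsto_Lp
    ((hv.comp hs).comp hs₁.tendsto_atTop)).exists_seq_tendsto_ae
  have h3 : ∀ᵐ x ∂(volume : Measure R3), ∀ n, v (s n) x = M x (u (s n) x) :=
    ae_all_iff.2 fun n => h (s n)
  filter_upwards [h1, h2, h3] with x h1 h2 h3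
  have h4 := ((M x).continuous.tendsto (u₀ x)).comp (h1.comp hs₂.tendsto_atTop)
  refine tendsto_nhds_unique h2 (h4.congr fun n => ?_)
  simp [h3]

theorem norm_sq_eq_integral (v : L2 F) : ‖v‖ ^ 2 = ∫ x, ‖v x‖ ^ 2 := by
  have h1 : inner ℂ v v = ∫ x, inner ℂ (v x) (v x) := L2.inner_def v v
  simp_rw [inner_self_eq_norm_sq_to_K] at h1
  have h2 : ((∫ x, ‖v x‖ ^ 2 : ℝ) : ℂ) = ∫ x, ((‖v x‖ : ℂ)) ^ 2 := by
    rw [← integral_complex_ofReal]; simp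
  apply Complex.ofReal_injective
  rw [h2]
  simpa using h1

theorem integrable_norm_sq {F : Type} [NormedAddCommGroup F] (v : L2 F) :
    Integrable (fun x => ‖v x‖ ^ 2) volume :=
  (memLp_two_iff_integrable_sq_norm (Lp.aestronglyMeasurable v)).1 (Lp.memLp v)

/-- If uniformly bounded multipliers converge pointwise, the multiplication operators converge
strongly. -/
theorem tendsto_of_isMul {ι : Type*} {l : Filter ι} [l.IsCountablyGenerated]
    {M : ι → R3 → F →L[ℂ] F} {M₀ : R3 → F →L[ℂ] F} {C : ℝ}
    (hC : ∀ᶠ i in l, ∀ᵐ x ∂(volume : Measure R3), ‖M i x‖ ≤ C)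
    (hM : ∀ᵐ x ∂(volume : Measure R3), Tendsto (fun i => M i x) l (𝓝 (M₀ x)))
    {u : L2 F} {v : ι → L2 F} {v₀ : L2 F} (hv : ∀ᶠ i in l, IsMul (M i) u (v i))
    (hv₀ : IsMul M₀ u v₀) :
    Tendsto v l (𝓝 v₀) := by
  -- the claim is dominated convergence for `‖(M i - M₀) u‖²`
  rw [tendsto_iff_norm_sub_tendsto_zero]
  have key : Tendsto (fun i => ∫ x, ‖M i x (u x) - v₀ x‖ ^ 2) l (𝓝 (∫ x : R3, (0 : ℝ))) := by
    refine tendsto_integral_filter_of_dominated_convergence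
      (fun x => 2 * (C ^ 2 * ‖u x‖ ^ 2) + 2 * ‖v₀ x‖ ^ 2) ?_ ?_ ?_ ?_
    · filter_upwards [hv] with i hi
      refine AEStronglyMeasurable.congr ((Lp.aestronglyMeasurable (v i - v₀)).norm.pow 2) ?_
      filter_upwards [hi, Lp.coeFn_sub (v i) v₀] with x h1 h2
      change ‖(v i - v₀) x‖ ^ 2 = _
      rw [h2, Pi.sub_apply, h1]
    · filter_upwards [hC] with i hi
      filter_upwards [hi] with x hx
      rw [Real.norm_of_nonneg (by positivity)]
      have h1 := (M i x).le_of_opNorm_le hx (u x)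
      have h2 := norm_sub_le (M i x (u x)) (v₀ x)
      have h3 : ‖M i x (u x) - v₀ x‖ ^ 2 ≤ (C * ‖u x‖ + ‖v₀ x‖) ^ 2 := by gcongr; linarith
      nlinarith [sq_nonneg (C * ‖u x‖ - ‖v₀ x‖)]
    · exact (((integrable_norm_sq u).const_mul _).const_mul _).add
        ((integrable_norm_sq v₀).const_mul _)
    · filter_upwards [hM, hv₀] with x h1 h2
      have h3 : Tendsto (fun i => M i x (u x)) l (𝓝 (M₀ x (u x))) :=
        ((ContinuousLinearMap.apply ℂ F (u x)).continuous.tendsto _).comp h1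
      rw [← h2] at h3
      simpa using (((h3.sub_const (v₀ x)).norm).pow 2)
  have h2 : ∀ᶠ i in l, ∫ x, ‖M i x (u x) - v₀ x‖ ^ 2 = ‖v i - v₀‖ ^ 2 := by
    filter_upwards [hv] with i hi
    rw [norm_sq_eq_integral]
    refine integral_congr_ae ?_
    filter_upwards [hi, Lp.coeFn_sub (v i) v₀] with x h1 h2
    simp only [h2, Pi.sub_apply, h1]
  rw [integral_zero] at key
  replace key := key.congr' h2
  simpa [Function.comp_def] using (Real.continuous_sqrt.tendsto _).comp key

/-- Multiplication by the scalar function `a`. -/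
def scalarMul (F : Type) [NormedAddCommGroup F] [InnerProductSpace ℂ F] (a : R3 → ℝ) (x : R3) :
    F →L[ℂ] F :=
  ((a x : ℝ) : ℂ) • ContinuousLinearMap.id ℂ F

theorem norm_scalarMul_le (a : R3 → ℝ) (x : R3) : ‖scalarMul F a x‖ ≤ |a x| := by
  rw [scalarMul, norm_smul]
  have := ContinuousLinearMap.norm_id_le (𝕜 := ℂ) (E := F)
  rw [Complex.norm_real, Real.norm_eq_abs]
  exact mul_le_of_le_one_right (abs_nonneg _) this

theorem aestronglyMeasurable_scalarMul {a : R3 → ℝ} (ha : Measurable a) :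
    AEStronglyMeasurable (scalarMul F a) volume :=
  (Complex.measurable_ofReal.comp ha).aestronglyMeasurable.smul_const _

variable [CompleteSpace F]

/-- The inverse Fourier transform of an integrable square integrable function is given by the
Fourier integral: both are the same tempered distribution. -/
theorem coeFn_fourierInv_of_integrable (h : L2 F) (hi : Integrable h volume) :
    (𝓕⁻ h : L2 F) =ᵐ[volume] fun x => ∫ ξ, Real.fourierChar (inner ℝ ξ x) • h ξ := by
  have hF : (𝓕⁻ (h : R3 → F)) = fun x => ∫ ξ, Real.fourierChar (inner ℝ ξ x) • h ξ := by
    ext x; rw [Real.fourierInv_eq]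
  have hcont : Continuous (𝓕⁻ (h : R3 → F)) :=
    VectorFourier.fourierIntegral_continuous Real.continuous_fourierChar
      (L := -innerₗ R3) (by
        have : Continuous fun p : R3 × R3 => -inner ℝ p.1 p.2 := by fun_prop
        exact this) hi
  rw [← hF]
  refine ae_eq_of_integral_contDiff_smul_eq ((Lp.memLp _).locallyIntegrable (by norm_num))
    hcont.locallyIntegrable fun g hg hgc => ?_
  have hg₁ : HasCompactSupport (Complex.ofRealCLM ∘ g) := hgc.comp_left rfl
  have hg₂ : ContDiff ℝ (⊤ : ℕ∞) (Complex.ofRealCLM ∘ g) := by fun_prop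
  set G := hg₁.toSchwartzMap hg₂ with hG
  have h1 : ∫ x, g x • (𝓕⁻ h : L2 F) x = Lp.toTemperedDistribution (𝓕⁻ h : L2 F) G := by
    simp [hG]
  have h2 : ∫ x, g x • (𝓕⁻ (h : R3 → F)) x = ∫ x, G x • (𝓕⁻ (h : R3 → F)) x := by
    simp [hG]
  rw [h1, h2, ← Lp.fourierInv_toTemperedDistribution_eq, TemperedDistribution.fourierInv_apply,
    Lp.toTemperedDistribution_apply, SchwartzMap.fourierInv_coe]
  have := VectorFourier.integral_fourierIntegral_smul_eq_flip (L := -innerₗ R3)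
    (μ := (volume : Measure R3)) (ν := (volume : Measure R3)) (f := G) (g := h)
    Real.continuous_fourierChar (by
        have : Continuous fun p : R3 × R3 => -inner ℝ p.1 p.2 := by fun_prop
        exact this) G.integrable hi
  have hflip : (-innerₗ R3).flip = -innerₗ R3 := by
    ext x y; simp [real_inner_comm]
  rw [hflip] at this
  exact this

theorem exists_fourierL2_eq (f : L2 F) : ∃ φ : L2 F, fourierL2 φ = f :=
  (Lp.fourierTransformₗᵢ R3 F).surjective f

theorem norm_fourierL2 (φ : L2 F) : ‖fourierL2 φ‖ = ‖φ‖ :=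
  (Lp.fourierTransformₗᵢ R3 F).norm_map φ

theorem inner_fourierL2 (φ ψ : L2 F) : inner ℂ (fourierL2 φ) (fourierL2 ψ) = inner ℂ φ ψ :=
  (Lp.fourierTransformₗᵢ R3 F).inner_map_map φ ψ

/-- `A = W a(ξ)`, the product of a Fourier multiplier with scalar symbol `a` (as a function of
`ξ = p / (2π)`) and of multiplication by `W`, on the domain of `a`. For bounded `a` this
determines the operator `A`. -/
def IsProd (W : R3 → F →L[ℂ] F) (a : R3 → ℝ) (A : L2 F →L[ℂ] L2 F) : Prop :=
  ∀ χ φ : L2 F, IsMul (scalarMul F a) (fourierL2 χ) (fourierL2 φ) → IsMul W φ (A χ)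

/-- A Fourier multiplier with bounded symbol is everywhere defined. -/
theorem exists_isMul_fourier {M : R3 → F →L[ℂ] F} {C : ℝ} (hM : AEStronglyMeasurable M volume)
    (hC : ∀ᵐ x ∂(volume : Measure R3), ‖M x‖ ≤ C) (χ : L2 F) :
    ∃ φ : L2 F, IsMul M (fourierL2 χ) (fourierL2 φ) := by
  obtain ⟨φ, hφ⟩ := exists_fourierL2_eq (mulOp M C hM hC (fourierL2 χ))
  exact ⟨φ, hφ ▸ isMul_mulOp hM hC _⟩

theorem IsProd.unique {W : R3 → F →L[ℂ] F} {a : R3 → ℝ} {A B : L2 F →L[ℂ] L2 F} {G : ℝ}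
    (ha : Measurable a) (hG : ∀ ξ, |a ξ| ≤ G) (hA : IsProd W a A) (hB : IsProd W a B) : A = B := by
  ext1 χ
  obtain ⟨φ, hφ⟩ := exists_isMul_fourier (aestronglyMeasurable_scalarMul (F := F) ha)
    (Eventually.of_forall fun ξ => (norm_scalarMul_le a ξ).trans (hG ξ)) χ
  exact (hA χ φ hφ).unique (hB χ φ hφ)

/-- The character `ξ ↦ e^{2πi ξ·x}`, as a multiplication operator. -/
def planeWave (x ξ : R3) : ℂ →L[ℂ] ℂ :=
  (Real.fourierChar (inner ℝ ξ x) : ℂ) • ContinuousLinearMap.id ℂ ℂ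

theorem continuous_planeWave : Continuous fun p : R3 × R3 => planeWave p.1 p.2 := by
  have : Continuous fun p : R3 × R3 => (Real.fourierChar (inner ℝ p.2 p.1) : ℂ) :=
    continuous_subtype_val.comp (Real.continuous_fourierChar.comp (by fun_prop))
  exact this.smul continuous_const

theorem norm_planeWave_le (x ξ : R3) : ‖planeWave x ξ‖ ≤ 1 := by
  rw [planeWave, norm_smul, Circle.norm_coe, one_mul]
  exact ContinuousLinearMap.norm_id_le

/-- The function `ξ ↦ e^{2πi ξ·x} h(ξ)` in `L₂`. -/
def modulate (h : L2 ℂ) (x : R3) : L2 ℂ :=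
  mulOp (planeWave x) 1 (continuous_planeWave.comp
    (Continuous.prodMk_right x)).aestronglyMeasurable (Eventually.of_forall (norm_planeWave_le x)) h

theorem isMul_modulate (h : L2 ℂ) (x : R3) : IsMul (planeWave x) h (modulate h x) :=
  isMul_mulOp _ _ _

theorem norm_modulate_le (h : L2 ℂ) (x : R3) : ‖modulate h x‖ ≤ ‖h‖ := by
  simpa using (isMul_modulate h x).norm_le (Eventually.of_forall (norm_planeWave_le x))

theorem continuous_modulate (h : L2 ℂ) : Continuous (modulate h) := by
  refine continuous_iff_continuousAt.2 fun x => ?_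
  refine tendsto_of_isMul (C := 1) (M := planeWave) (M₀ := planeWave x) (u := h)
    (Eventually.of_forall fun y => Eventually.of_forall (norm_planeWave_le y))
    (Eventually.of_forall fun ξ => ?_) (Eventually.of_forall fun y => isMul_modulate h y)
    (isMul_modulate h x)
  exact (continuous_planeWave.comp (Continuous.prodMk_left ξ)).tendsto x

variable (F) in
/-- The pairing `(h, φ) ↦ ∫ h φ`. -/
def pairL : L2 ℂ →L[ℂ] L2 F →L[ℂ] F :=
  ContinuousLinearMap.lpPairing volume 2 2 (ContinuousLinearMap.lsmul ℂ ℂ)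

theorem pairL_apply (h : L2 ℂ) (φ : L2 F) : pairL F h φ = ∫ ξ, h ξ • φ ξ :=
  ContinuousLinearMap.lpPairing_eq_integral _ _ _

theorem norm_pairL_apply_le (h : L2 ℂ) : ‖pairL F h‖ ≤ ‖h‖ := by
  refine ContinuousLinearMap.opNorm_le_bound _ (norm_nonneg _) fun φ => ?_
  have h1 := L1.norm_integral_le ((ContinuousLinearMap.lsmul ℂ ℂ).holder 1 h φ)
  rw [L1.integral_eq_integral, integral_congr_ae (ContinuousLinearMap.coeFn_holder _ h φ)] at h1
  rw [pairL_apply]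
  refine h1.trans ((ContinuousLinearMap.norm_holder_apply_apply_le _ _ _).trans ?_)
  have h2 := ContinuousLinearMap.opNorm_lsmul_le (𝕜 := ℂ) (R := ℂ) (E := F)
  rw [mul_assoc]
  exact mul_le_of_le_one_left (by positivity) h2

/-- The Hilbert-Schmidt criterion: `W(x) a(ξ)` is a compact operator if `W` and `a` are square
integrable. -/
theorem exists_isProd_of_memLp_two [FiniteDimensional ℂ F] {W : R3 → F →L[ℂ] F}
    (hW : MemLp W 2 volume) {a : R3 → ℝ} (ha : MemLp a 2 volume) :
    ∃ A : L2 F →L[ℂ] L2 F, IsProd W a A ∧ IsCompactOperator A ∧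
      ‖A‖ ≤ (eLpNorm a 2 volume).toReal * (eLpNorm W 2 volume).toReal := by
  have hac : MemLp (fun ξ => (a ξ : ℂ)) 2 (volume : Measure R3) := ha.ofReal
  set h : L2 ℂ := hac.toLp _ with hh
  have hnorm : ‖h‖ = (eLpNorm a 2 volume).toReal := by
    rw [hh, Lp.norm_toLp]
    congr 1
    exact eLpNorm_congr_norm_ae (Eventually.of_forall fun ξ => by simp)
  obtain ⟨T, hTc, hT, hTn⟩ := exists_isCompactOperator_kernel hW
    (e := fun x => pairL F (modulate h x)) ((pairL F).continuous.comp (continuous_modulate h))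
    (fun x => (norm_pairL_apply_le _).trans (norm_modulate_le h x)) (norm_nonneg h)
  rw [hnorm] at hTn
  set U : L2 F →L[ℂ] L2 F := (Lp.fourierTransformₗᵢ R3 F).toLinearIsometry.toContinuousLinearMap
    with hU
  refine ⟨T ∘L U, fun χ φ hφ => ?_, hTc.comp_clm U, ?_⟩
  · have hint : Integrable (fourierL2 φ) volume := by
      have h1 : Integrable (fun ξ => (a ξ : ℂ) • fourierL2 χ ξ) volume :=
        memLp_one_iff_integrable.1
          ((ContinuousLinearMap.lsmul ℂ ℂ).memLp_of_bilin 1 hac (Lp.memLp (fourierL2 χ)))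
      refine h1.congr ?_
      filter_upwards [hφ] with ξ hξ
      simp [hξ, scalarMul]
    have h2 := coeFn_fourierInv_of_integrable (fourierL2 φ) hint
    rw [show 𝓕⁻ (fourierL2 φ) = φ from (Lp.fourierTransformₗᵢ R3 F).symm_apply_apply φ] at h2
    filter_upwards [h2, hT (U χ)] with x h3 h4
    have h6 : (T ∘L U) χ x = W x (pairL F (modulate h x) (fourierL2 χ)) := by
      rw [ContinuousLinearMap.comp_apply, h4]
      rfl
    rw [h6, h3, pairL_apply]
    congr 1
    refine integral_congr_ae ?_
    filter_upwards [hφ, isMul_modulate h x, hac.coeFn_toLp] with ξ h7 h8 h9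
    rw [h8, hh, h9, h7]
    simp [planeWave, scalarMul, Circle.smul_def, mul_smul]
  · have h1 : ‖U‖ ≤ 1 := (Lp.fourierTransformₗᵢ R3 F).toLinearIsometry.norm_toContinuousLinearMap_le
    calc ‖T ∘L U‖ ≤ ‖T‖ * ‖U‖ := ContinuousLinearMap.opNorm_comp_le _ _
      _ ≤ ‖T‖ := mul_le_of_le_one_right (norm_nonneg _) h1
      _ ≤ _ := hTn

end Multipliers

/-! ### The products `W a(-i∇)` for bounded compactly supported symbols -/

section Products

theorem memLp_two_of_sq_le {E : Type*} [NormedAddCommGroup E] {f : R3 → E} {b : R3 → ℝ}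
    (hf : AEStronglyMeasurable f volume) (hb : Integrable b volume) (hfb : ∀ x, ‖f x‖ ^ 2 ≤ b x) :
    MemLp f 2 volume ∧ (eLpNorm f 2 volume).toReal ≤ √(∫ x, b x) := by
  have hint : Integrable (fun x => ‖f x‖ ^ 2) volume :=
    hb.mono' (hf.norm.pow 2) (Eventually.of_forall fun x => by
      rw [Real.norm_of_nonneg (by positivity)]; exact hfb x)
  have hmem : MemLp f 2 volume := (memLp_two_iff_integrable_sq_norm hf).2 hint
  refine ⟨hmem, ?_⟩
  rw [hmem.eLpNorm_eq_integral_rpow_norm (by norm_num) (by norm_num), ENNReal.toReal_ofReal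
    (by positivity)]
  rw [Real.sqrt_eq_rpow]
  have : ∫ x, ‖f x‖ ^ (2 : ENNReal).toReal ≤ ∫ x, b x := by
    simp only [ENNReal.toReal_ofNat, Real.rpow_ofNat]
    exact integral_mono hint hb hfb
  have h2 : (2 : ENNReal).toReal⁻¹ = 1 / 2 := by norm_num
  rw [h2]
  exact Real.rpow_le_rpow (by positivity) this (by norm_num)

variable {F : Type} [NormedAddCommGroup F] [InnerProductSpace ℂ F] [CompleteSpace F]

/-- The product of a bounded multiplication operator and a bounded Fourier multiplier. -/
theorem exists_isProd_of_bounded {W : R3 → F →L[ℂ] F} (hW : AEStronglyMeasurable W volume)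
    {τ : ℝ} (hτ : 0 ≤ τ) (hWτ : ∀ x, ‖W x‖ ≤ τ) {a : R3 → ℝ} (ha : Measurable a) {G : ℝ}
    (hG0 : 0 ≤ G) (hG : ∀ ξ, |a ξ| ≤ G) :
    ∃ B : L2 F →L[ℂ] L2 F, IsProd W a B ∧ ‖B‖ ≤ τ * G := by
  have ham := aestronglyMeasurable_scalarMul (F := F) ha
  have haG : ∀ᵐ ξ ∂(volume : Measure R3), ‖scalarMul F a ξ‖ ≤ G :=
    Eventually.of_forall fun ξ => (norm_scalarMul_le a ξ).trans (hG ξ)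
  have hWτ' := Eventually.of_forall (f := ae (volume : Measure R3)) hWτ
  set U : L2 F →L[ℂ] L2 F := (Lp.fourierTransformₗᵢ R3 F).toLinearIsometry.toContinuousLinearMap
    with hU
  set U' : L2 F →L[ℂ] L2 F :=
    (Lp.fourierTransformₗᵢ R3 F).symm.toLinearIsometry.toContinuousLinearMap with hU'
  refine ⟨mulOp W τ hW hWτ' ∘L U' ∘L mulOp (scalarMul F a) G ham haG ∘L U, fun χ φ hφ => ?_, ?_⟩
  · have h1 : mulOp (scalarMul F a) G ham haG (fourierL2 χ) = fourierL2 φ :=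
      (isMul_mulOp ham haG _).unique hφ
    have h2 : U' (fourierL2 φ) = φ := (Lp.fourierTransformₗᵢ R3 F).symm_apply_apply φ
    change IsMul W φ (mulOp W τ hW hWτ' (U' (mulOp (scalarMul F a) G ham haG (fourierL2 χ))))
    rw [h1, h2]
    exact isMul_mulOp hW hWτ' φ
  · refine ContinuousLinearMap.opNorm_le_bound _ (by positivity) fun u => ?_
    simp only [ContinuousLinearMap.comp_apply]
    refine ((isMul_mulOp hW hWτ' _).norm_le hWτ').trans ?_
    rw [mul_assoc]
    gcongr
    have h1 : ∀ v, ‖U' v‖ = ‖v‖ := (Lp.fourierTransformₗᵢ R3 F).symm.norm_map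
    rw [h1]
    refine ((isMul_mulOp ham haG _).norm_le haG).trans ?_
    gcongr
    exact (norm_fourierL2 u).le

theorem IsProd.add_left {W₁ W₂ : R3 → F →L[ℂ] F} {a : R3 → ℝ} {A B : L2 F →L[ℂ] L2 F}
    (hA : IsProd W₁ a A) (hB : IsProd W₂ a B) : IsProd (W₁ + W₂) a (A + B) := by
  intro χ φ h
  filter_upwards [hA χ φ h, hB χ φ h, Lp.coeFn_add (A χ) (B χ)] with x h1 h2 h3
  rw [add_apply, h3, Pi.add_apply, h1, h2]
  rfl

variable [FiniteDimensional ℂ F]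

/-- Splitting `W` at the height `τ`: the large part is square integrable, so the Hilbert-Schmidt
criterion applies to it, and the small part is bounded by `τ`. As `τ → 0` this shows compactness,
while a good choice of `τ` gives a norm bound. -/
theorem exists_isProd_of_bounded_support {W : R3 → F →L[ℂ] F}
    (hW : AEStronglyMeasurable W volume) {p : ℝ} (hp : 2 ≤ p)
    (hWp : Integrable (fun x => ‖W x‖ ^ p) volume) {a : R3 → ℝ} (ha : Measurable a) {G R : ℝ}
    (hG0 : 0 ≤ G) (hG : ∀ ξ, |a ξ| ≤ G) (haR : ∀ ξ, ξ ∉ Metric.ball 0 R → a ξ = 0) :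
    ∃ A : L2 F →L[ℂ] L2 F, IsProd W a A ∧ IsCompactOperator A ∧ ∀ τ > 0,
      ‖A‖ ≤ τ * G + G * √(volume.real (Metric.ball (0 : R3) R)) *
        √(τ ^ (2 - p) * ∫ x, ‖W x‖ ^ p) := by
  obtain ⟨ha2, ha2n⟩ := memLp_two_of_sq_le (f := a)
    (b := (Metric.ball (0 : R3) R).indicator fun _ => G ^ 2) ha.aestronglyMeasurable
    ((integrable_indicator_iff measurableSet_ball).2
      (integrableOn_const measure_ball_lt_top.ne)) (fun ξ => by
        by_cases hξ : ξ ∈ Metric.ball (0 : R3) R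
        · rw [Set.indicator_of_mem hξ]
          have := hG ξ
          gcongr
          exact this
        · rw [Set.indicator_of_notMem hξ, haR ξ hξ]; simp)
  rw [integral_indicator measurableSet_ball, setIntegral_const, smul_eq_mul,
    Real.sqrt_mul measureReal_nonneg, Real.sqrt_sq hG0, mul_comm] at ha2n
  -- the two parts of `A` at height `τ`
  have key : ∀ τ > 0, ∃ A B : L2 F →L[ℂ] L2 F, IsProd W a (A + B) ∧ IsCompactOperator A ∧
      ‖B‖ ≤ τ * G ∧ ‖A‖ ≤ G * √(volume.real (Metric.ball (0 : R3) R)) *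
        √(τ ^ (2 - p) * ∫ x, ‖W x‖ ^ p) := by
    intro τ hτ
    set s : Set R3 := {x | τ < ‖W x‖} with hs
    have hsm : NullMeasurableSet s volume :=
      nullMeasurableSet_lt aemeasurable_const hW.norm.aemeasurable
    obtain ⟨hW2, hW2n⟩ := memLp_two_of_sq_le (f := s.indicator W)
      (b := fun x => τ ^ (2 - p) * ‖W x‖ ^ p) (hW.indicator₀ hsm) (hWp.const_mul _) (fun x => by
        by_cases hx : x ∈ s
        · rw [Set.indicator_of_mem hx]
          have hx' : τ < ‖W x‖ := hx
          have hpos : 0 < ‖W x‖ := hτ.trans hx'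
          calc ‖W x‖ ^ 2 = ‖W x‖ ^ (2 - p) * ‖W x‖ ^ p := by
                rw [← Real.rpow_add hpos, sub_add_cancel, Real.rpow_ofNat]
            _ ≤ τ ^ (2 - p) * ‖W x‖ ^ p := by
                exact mul_le_mul_of_nonneg_right
                  (Real.rpow_le_rpow_of_nonpos hτ hx'.le (by linarith)) (by positivity)
        · rw [Set.indicator_of_notMem hx]
          rw [norm_zero, zero_pow two_ne_zero]
          positivity)
    rw [integral_const_mul] at hW2n
    obtain ⟨A, hA, hAc, hAn⟩ := exists_isProd_of_memLp_two hW2 ha2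
    obtain ⟨B, hB, hBn⟩ := exists_isProd_of_bounded (W := sᶜ.indicator W) (hW.indicator₀ hsm.compl)
      hτ.le (fun x => by
        by_cases hx : x ∈ s
        · simp [hx, hτ.le]
        · rw [Set.indicator_of_mem (by exact hx)]
          exact not_lt.1 hx) ha hG0 hG
    refine ⟨A, B, ?_, hAc, hBn, hAn.trans (by gcongr)⟩
    have := hA.add_left hB
    rwa [Set.indicator_self_add_compl] at this
  choose! A B hAB hAc hBn hAn using key
  have hAB' : ∀ τ > 0, A τ + B τ = A 1 + B 1 := fun τ hτ =>
    (hAB τ hτ).unique ha hG (hAB 1 one_pos)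
  refine ⟨A 1 + B 1, hAB 1 one_pos, ?_, fun τ hτ => ?_⟩
  · have hlim : Tendsto (fun n : ℕ => A (1 / ((n : ℝ) + 1))) atTop (𝓝 (A 1 + B 1)) := by
      rw [tendsto_iff_norm_sub_tendsto_zero]
      have h0 : Tendsto (fun n : ℕ => 1 / ((n : ℝ) + 1) * G) atTop (𝓝 0) := by
        simpa using tendsto_one_div_add_atTop_nhds_zero_nat.mul_const G
      refine squeeze_zero (fun _ => norm_nonneg _) (fun n => ?_) h0
      have hn : (0 : ℝ) < 1 / ((n : ℝ) + 1) := by positivity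
      rw [← hAB' _ hn, sub_add_cancel_left, norm_neg]
      exact hBn _ hn
    exact isCompactOperator_of_tendsto hlim (Eventually.of_forall fun n => hAc _ (by positivity))
  · rw [← hAB' τ hτ, add_comm]
    exact (norm_add_le _ _).trans (add_le_add (hBn τ hτ) (hAn τ hτ))

/-- The bound on a momentum shell `|ξ| ~ ρ`, obtained by splitting `W` at the height at which the
two parts contribute equally. -/
theorem exists_isProd_shell {W : R3 → F →L[ℂ] F}
    (hW : AEStronglyMeasurable W volume) {p : ℝ} (hp : 2 ≤ p)
    (hWp : Integrable (fun x => ‖W x‖ ^ p) volume) :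
    ∃ C : ℝ, 0 ≤ C ∧ ∀ (a : R3 → ℝ) (G ρ : ℝ), Measurable a → 0 ≤ G → 0 < ρ → (∀ ξ, |a ξ| ≤ G) →
      (∀ ξ, ξ ∉ Metric.ball 0 (2 * ρ) → a ξ = 0) →
      ∃ A : L2 F →L[ℂ] L2 F, IsProd W a A ∧ IsCompactOperator A ∧ ‖A‖ ≤ C * G * ρ ^ (3 / p) := by
  set J := ∫ x, ‖W x‖ ^ p with hJ
  have hJ0 : 0 ≤ J := integral_nonneg fun x => by positivity
  set c := volume.real (Metric.ball (0 : R3) 1) with hc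
  have hc0 : 0 ≤ c := measureReal_nonneg
  refine ⟨1 + √(8 * c * J), by positivity, fun a G ρ ha hG0 hρ hG haR => ?_⟩
  obtain ⟨A, hA, hAc, hAn⟩ := exists_isProd_of_bounded_support hW hp hWp ha hG0 hG haR
  refine ⟨A, hA, hAc, ?_⟩
  set τ := ρ ^ (3 / p) with hτ
  have hτ0 : 0 < τ := Real.rpow_pos_of_pos hρ _
  refine (hAn τ hτ0).trans (le_of_eq ?_)
  have hvol : volume.real (Metric.ball (0 : R3) (2 * ρ)) = (2 * ρ) ^ 3 * c := by
    rw [measureReal_def, Measure.addHaar_ball _ _ (by positivity), ENNReal.toReal_mul,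
      ENNReal.toReal_ofReal (by positivity), finrank_euclideanSpace_fin]
    rfl
  have h1 : ρ ^ 3 * τ ^ (2 - p) = τ ^ 2 := by
    rw [hτ, ← Real.rpow_mul hρ.le, ← Real.rpow_natCast, ← Real.rpow_natCast, ← Real.rpow_mul hρ.le,
      ← Real.rpow_add hρ]
    congr 1
    have : p ≠ 0 := by linarith
    push_cast
    field_simp
    ring
  have h2 : √((2 * ρ) ^ 3 * c) * √(τ ^ (2 - p) * J) = τ * √(8 * c * J) := by
    rw [← Real.sqrt_mul (by positivity)]
    rw [show (2 * ρ) ^ 3 * c * (τ ^ (2 - p) * J) = (ρ ^ 3 * τ ^ (2 - p)) * (8 * c * J) by ring, h1,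
      Real.sqrt_mul (by positivity), Real.sqrt_sq hτ0.le]
  rw [hvol, mul_assoc G, h2]
  ring

end Products

/-! ### Compactness of `W g(-i∇)` -/

section Weight

/-- The momentum weight `g(ξ)`: `|ξ|⁻¹` for small and `|ξ|^{-b}` for large `ξ`. Its value `0` at the
single point `ξ = 0` is irrelevant. The square of `g` dominates the resolvents `(t - E)⁻¹`, with
`b = 1` for a kinetic energy growing like `|ξ|²` and `b = 1 / 2` for one growing like `|ξ|`. -/
def weight (b : ℝ) (ξ : R3) : ℝ := if ‖ξ‖ < 1 then ‖ξ‖⁻¹ else ‖ξ‖ ^ (-b)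

/-- The annulus `2^{-N} ≤ |ξ| < 2^N` in momentum space. -/
def annulus (N : ℕ) : Set R3 := {ξ | ((2 : ℝ) ^ N)⁻¹ ≤ ‖ξ‖ ∧ ‖ξ‖ < 2 ^ N}

theorem measurable_weight (b : ℝ) : Measurable (weight b) :=
  Measurable.ite (measurableSet_lt measurable_norm measurable_const) measurable_norm.inv
    (measurable_norm.pow_const _)

theorem measurableSet_annulus (N : ℕ) : MeasurableSet (annulus N) :=
  (measurableSet_le measurable_const measurable_norm).inter
    (measurableSet_lt measurable_norm measurable_const)

theorem weight_nonneg (b : ℝ) (ξ : R3) : 0 ≤ weight b ξ := by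
  unfold weight; split_ifs <;> positivity

theorem weight_pos (b : ℝ) {ξ : R3} (hξ : ξ ≠ 0) : 0 < weight b ξ := by
  have := norm_pos_iff.2 hξ
  unfold weight; split_ifs <;> positivity

theorem weight_le_of_one_le {b : ℝ} (hb : 0 ≤ b) {ξ : R3} {r : ℝ} (hr : 1 ≤ r) (h : r ≤ ‖ξ‖) :
    weight b ξ ≤ r ^ (-b) := by
  rw [weight, if_neg (by linarith)]
  exact Real.rpow_le_rpow_of_nonpos (by linarith) h (by linarith)

theorem weight_le_of_le_one {b : ℝ} (hb : 0 ≤ b) {ξ : R3} {r : ℝ} (hr0 : 0 < r) (hr : r ≤ 1)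
    (h : r ≤ ‖ξ‖) : weight b ξ ≤ r⁻¹ := by
  have h1 : 1 ≤ r⁻¹ := (one_le_inv₀ hr0).2 hr
  unfold weight; split_ifs with h2
  · exact inv_anti₀ hr0 h
  · exact (Real.rpow_le_one_of_one_le_of_nonpos (not_lt.1 h2) (by linarith)).trans h1

theorem weight_le_of_mem_annulus {b : ℝ} (hb : 0 ≤ b) {N : ℕ} {ξ : R3} (h : ξ ∈ annulus N) :
    weight b ξ ≤ 2 ^ N := by
  have h1 : (1 : ℝ) ≤ 2 ^ N := one_le_pow₀ (by norm_num)
  simpa using weight_le_of_le_one hb (by positivity) (inv_le_one_of_one_le₀ h1) h.1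

theorem ae_ne_zero : ∀ᵐ ξ ∂(volume : Measure R3), ξ ≠ 0 :=
  compl_mem_ae_iff.2 (measure_singleton _)

theorem eventually_mem_annulus {ξ : R3} (hξ : ξ ≠ 0) : ∀ᶠ N in atTop, ξ ∈ annulus N := by
  have hpos := norm_pos_iff.2 hξ
  have h1 : Tendsto (fun N : ℕ => (2 : ℝ) ^ N) atTop atTop :=
    tendsto_pow_atTop_atTop_of_one_lt (by norm_num)
  filter_upwards [h1.eventually_gt_atTop ‖ξ‖, h1.inv_tendsto_atTop.eventually_le_const hpos]
    with N h2 h3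
  exact ⟨h3, h2⟩

variable {F : Type} [NormedAddCommGroup F] [InnerProductSpace ℂ F]

theorem IsMul.add {M : R3 → F →L[ℂ] F} {u u' v v' : L2 F} (h : IsMul M u v) (h' : IsMul M u' v') :
    IsMul M (u + u') (v + v') := by
  filter_upwards [h, h', Lp.coeFn_add u u', Lp.coeFn_add v v'] with x h1 h2 h3 h4
  rw [h3, h4, Pi.add_apply, Pi.add_apply, map_add, h1, h2]

theorem tendsto_indicator_mul {u : L2 F} {v : ℕ → L2 F}
    (hv : ∀ N, IsMul (scalarMul F ((annulus N).indicator 1)) u (v N)) :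
    Tendsto v atTop (𝓝 u) := by
  refine tendsto_of_isMul (C := 1) (M₀ := scalarMul F 1)
    (Eventually.of_forall fun N => Eventually.of_forall fun ξ => ?_) ?_ (Eventually.of_forall hv)
    (Eventually.of_forall fun ξ => by simp [scalarMul])
  · refine (norm_scalarMul_le _ _).trans ?_
    by_cases hξ : ξ ∈ annulus N <;> simp [hξ]
  · filter_upwards [ae_ne_zero] with ξ hξ
    refine tendsto_const_nhds.congr' ?_
    filter_upwards [eventually_mem_annulus hξ] with N hN
    simp [scalarMul, hN]

variable [CompleteSpace F]

theorem tendsto_of_tendsto_fourierL2 {ι : Type*} {l : Filter ι} {v : ι → L2 F} {u : L2 F}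
    (h : Tendsto (fun i => fourierL2 (v i)) l (𝓝 (fourierL2 u))) : Tendsto v l (𝓝 u) :=
  (Lp.fourierTransformₗᵢ R3 F).toHomeomorph.isInducing.tendsto_nhds_iff.2 h

theorem fourierL2_add (u v : L2 F) : fourierL2 (u + v) = fourierL2 u + fourierL2 v :=
  map_add (Lp.fourierTransformₗᵢ R3 F) u v

theorem fourierL2_injective : Function.Injective (fourierL2 (F := F)) :=
  (Lp.fourierTransformₗᵢ R3 F).injective

theorem IsProd.add_right {W : R3 → F →L[ℂ] F} {a₁ a₂ : R3 → ℝ} {A B : L2 F →L[ℂ] L2 F} {G₁ G₂ : ℝ}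
    (h₁ : Measurable a₁) (h₂ : Measurable a₂) (hG₁ : ∀ ξ, |a₁ ξ| ≤ G₁) (hG₂ : ∀ ξ, |a₂ ξ| ≤ G₂)
    (hA : IsProd W a₁ A) (hB : IsProd W a₂ B) : IsProd W (a₁ + a₂) (A + B) := by
  intro χ φ h
  obtain ⟨φ₁, hφ₁⟩ := exists_isMul_fourier (aestronglyMeasurable_scalarMul (F := F) h₁)
    (Eventually.of_forall fun ξ => (norm_scalarMul_le a₁ ξ).trans (hG₁ ξ)) χ
  obtain ⟨φ₂, hφ₂⟩ := exists_isMul_fourier (aestronglyMeasurable_scalarMul (F := F) h₂)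
    (Eventually.of_forall fun ξ => (norm_scalarMul_le a₂ ξ).trans (hG₂ ξ)) χ
  have : φ = φ₁ + φ₂ := by
    refine fourierL2_injective ?_
    rw [fourierL2_add]
    refine Lp.ext ?_
    filter_upwards [h, hφ₁, hφ₂, Lp.coeFn_add (fourierL2 φ₁) (fourierL2 φ₂)] with ξ h1 h2 h3 h4
    rw [h1, h4, Pi.add_apply, h2, h3]
    simp [scalarMul, add_smul]
  rw [this]
  exact (hA χ φ₁ hφ₁).add (hB χ φ₂ hφ₂)

variable [FiniteDimensional ℂ F]

/-- `W(x) g(ξ)` is a compact operator: by the bounds on momentum shells, the dyadic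
decomposition of `g` converges geometrically in operator norm. The shell `|ξ| ~ ρ` contributes
`ρ^{3/p₁ - 1}` for small `ρ`, which requires `p₁ < 3`, and `ρ^{3/p₂ - b}` for large `ρ`, which
requires `p₂ b > 3`. -/
theorem exists_isProd_weight {W : R3 → F →L[ℂ] F} (hW : AEStronglyMeasurable W volume)
    {b p₁ p₂ : ℝ} (hb : 0 ≤ b) (hp₁ : 2 ≤ p₁) (hp₁' : p₁ < 3) (hp₂ : 2 ≤ p₂) (hp₂b : 3 < p₂ * b)
    (hW₁ : Integrable (fun x => ‖W x‖ ^ p₁) volume)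
    (hW₂ : Integrable (fun x => ‖W x‖ ^ p₂) volume) :
    ∃ A : L2 F →L[ℂ] L2 F, IsProd W (weight b) A ∧ IsCompactOperator A := by
  obtain ⟨C₁, hC₁, hlo⟩ := exists_isProd_shell hW hp₁ hW₁
  obtain ⟨C₂, hC₂, hhi⟩ := exists_isProd_shell hW hp₂ hW₂
  set a : ℕ → R3 → ℝ := fun N => (annulus N).indicator (weight b) with ha
  have ham : ∀ N, Measurable (a N) := fun N =>
    (measurable_weight b).indicator (measurableSet_annulus N)
  have haG : ∀ N ξ, |a N ξ| ≤ 2 ^ N := fun N ξ => by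
    by_cases hξ : ξ ∈ annulus N
    · simpa [ha, hξ, abs_of_nonneg (weight_nonneg b ξ)] using weight_le_of_mem_annulus hb hξ
    · simp [ha, hξ]
  have hA : ∀ N, ∃ A : L2 F →L[ℂ] L2 F, IsProd W (a N) A ∧ IsCompactOperator A := fun N => by
    obtain ⟨A, h1, h2, -⟩ := hlo (a N) (2 ^ N) (2 ^ N) (ham N) (by positivity) (by positivity)
      (haG N) (fun ξ hξ => by
        refine Set.indicator_of_notMem (fun h => hξ ?_) _
        rw [mem_ball_zero_iff]
        have : (0 : ℝ) < 2 ^ N := by positivity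
        linarith [h.2])
    exact ⟨A, h1, h2⟩
  choose A hA hAc using hA
  set θ₁ : ℝ := 2 ^ (1 - 3 / p₁) with hθ₁
  set θ₂ : ℝ := 2 ^ (3 / p₂ - b) with hθ₂
  have hθ₁' : θ₁ < 1 := Real.rpow_lt_one_of_one_lt_of_neg (by norm_num) (by
    rw [sub_neg, lt_div_iff₀ (by linarith)]; linarith)
  have hθ₂' : θ₂ < 1 := Real.rpow_lt_one_of_one_lt_of_neg (by norm_num) (by
    rw [sub_neg, div_lt_iff₀ (by linarith)]; linarith)
  -- passing from `A N` to `A (N + 1)` adds one low and one high momentum shell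
  have hstep : ∀ N, dist (A N) (A (N + 1)) ≤ 2 * C₁ * θ₁ ^ N + C₂ * θ₂ ^ N := by
    intro N
    have h2N : (1 : ℝ) ≤ 2 ^ N := one_le_pow₀ (by norm_num)
    have h2N' : (0 : ℝ) < 2 ^ N := by positivity
    set sl : Set R3 := {ξ | ((2 : ℝ) ^ (N + 1))⁻¹ ≤ ‖ξ‖ ∧ ‖ξ‖ < ((2 : ℝ) ^ N)⁻¹} with hsl
    set sh : Set R3 := {ξ | (2 : ℝ) ^ N ≤ ‖ξ‖ ∧ ‖ξ‖ < 2 ^ (N + 1)} with hsh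
    have hslm : MeasurableSet sl := (measurableSet_le measurable_const measurable_norm).inter
      (measurableSet_lt measurable_norm measurable_const)
    have hshm : MeasurableSet sh := (measurableSet_le measurable_const measurable_norm).inter
      (measurableSet_lt measurable_norm measurable_const)
    have hlG : ∀ ξ, |sl.indicator (weight b) ξ| ≤ 2 ^ (N + 1) := fun ξ => by
      by_cases hξ : ξ ∈ sl
      · rw [Set.indicator_of_mem hξ, abs_of_nonneg (weight_nonneg b ξ)]
        simpa using weight_le_of_le_one hb (by positivity)
          (inv_le_one_of_one_le₀ (one_le_pow₀ (by norm_num))) hξ.1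
      · rw [Set.indicator_of_notMem hξ]; simp
    have hhG : ∀ ξ, |sh.indicator (weight b) ξ| ≤ ((2 : ℝ) ^ N) ^ (-b) := fun ξ => by
      by_cases hξ : ξ ∈ sh
      · rw [Set.indicator_of_mem hξ, abs_of_nonneg (weight_nonneg b ξ)]
        exact weight_le_of_one_le hb h2N hξ.1
      · rw [Set.indicator_of_notMem hξ]; simp; positivity
    obtain ⟨L, hL, -, hLn⟩ := hlo (sl.indicator (weight b)) (2 ^ (N + 1)) ((2 ^ N)⁻¹)
      ((measurable_weight b).indicator hslm) (by positivity) (by positivity) hlG (fun ξ hξ => by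
        refine Set.indicator_of_notMem (fun h => hξ ?_) _
        rw [mem_ball_zero_iff]
        have : (0 : ℝ) < (2 ^ N)⁻¹ := by positivity
        linarith [h.2])
    obtain ⟨U, hU, -, hUn⟩ := hhi (sh.indicator (weight b)) (((2 : ℝ) ^ N) ^ (-b)) (2 ^ N)
      ((measurable_weight b).indicator hshm) (by positivity) (by positivity) hhG (fun ξ hξ => by
        refine Set.indicator_of_notMem (fun h => hξ ?_) _
        rw [mem_ball_zero_iff, ← pow_succ']
        exact h.2)
    have hsum : A (N + 1) = A N + L + U := by
      refine (hA (N + 1)).unique (ham _) (haG _) ?_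
      have h1 := (hA N).add_right (ham N) ((measurable_weight b).indicator hslm) (haG N) hlG hL
      have h2 := h1.add_right ((ham N).add ((measurable_weight b).indicator hslm))
        ((measurable_weight b).indicator hshm)
        (fun ξ => (abs_add_le _ _).trans (add_le_add (haG N ξ) (hlG ξ))) hhG hU
      convert h2 using 1
      funext ξ
      have e : ((2 : ℝ) ^ (N + 1))⁻¹ ≤ (2 ^ N)⁻¹ := by
        gcongr <;> norm_num
      have e' : (2 : ℝ) ^ N ≤ 2 ^ (N + 1) := by gcongr <;> norm_num
      have e'' : ((2 : ℝ) ^ N)⁻¹ ≤ 1 := inv_le_one_of_one_le₀ h2N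
      simp only [ha, annulus, hsl, hsh, Pi.add_apply, Set.indicator_apply, Set.mem_ofPred_eq]
      rcases lt_or_ge ‖ξ‖ (2 ^ N)⁻¹ with h | h
      · rw [if_neg (fun h' : (2 ^ N)⁻¹ ≤ ‖ξ‖ ∧ ‖ξ‖ < 2 ^ N => absurd h'.1 (not_le.2 h)),
          if_neg (fun h' : 2 ^ N ≤ ‖ξ‖ ∧ ‖ξ‖ < 2 ^ (N + 1) => by linarith [h'.1])]
        by_cases h3 : ((2 : ℝ) ^ (N + 1))⁻¹ ≤ ‖ξ‖
        · rw [if_pos ⟨h3, by linarith⟩, if_pos ⟨h3, h⟩]; ring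
        · rw [if_neg (fun h' => h3 h'.1), if_neg (fun h' => h3 h'.1)]; ring
      · rw [if_neg (fun h' : (2 ^ (N + 1))⁻¹ ≤ ‖ξ‖ ∧ ‖ξ‖ < (2 ^ N)⁻¹ =>
          absurd h'.2 (not_lt.2 h))]
        rcases lt_or_ge ‖ξ‖ (2 ^ N) with h3 | h3
        · rw [if_pos ⟨e.trans h, h3.trans_le e'⟩, if_pos ⟨h, h3⟩,
            if_neg (fun h' => absurd h'.1 (not_le.2 h3))]
          ring
        · rw [if_neg (fun h' : (2 ^ N)⁻¹ ≤ ‖ξ‖ ∧ ‖ξ‖ < 2 ^ N => absurd h'.2 (not_lt.2 h3))]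
          by_cases h4 : ‖ξ‖ < 2 ^ (N + 1)
          · rw [if_pos ⟨e.trans h, h4⟩, if_pos ⟨h3, h4⟩]; ring
          · rw [if_neg (fun h' => h4 h'.2), if_neg (fun h' => h4 h'.2)]; ring
    have hp₁0 : p₁ ≠ 0 := by linarith
    have e1 : (2 : ℝ) ^ (N + 1) * ((2 ^ N)⁻¹) ^ (3 / p₁) = 2 * θ₁ ^ N := by
      rw [hθ₁, pow_succ', Real.inv_rpow (by positivity), ← Real.rpow_natCast, ← Real.rpow_natCast,
        ← Real.rpow_mul (by norm_num), ← Real.rpow_mul (by norm_num), ← Real.rpow_neg (by norm_num),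
        mul_assoc, ← Real.rpow_add (by norm_num)]
      ring_nf
    have e2 : ((2 : ℝ) ^ N) ^ (-b) * (2 ^ N) ^ (3 / p₂) = θ₂ ^ N := by
      rw [hθ₂, ← Real.rpow_natCast, ← Real.rpow_natCast,
        ← Real.rpow_mul (by norm_num), ← Real.rpow_mul (by norm_num),
        ← Real.rpow_mul (by norm_num), ← Real.rpow_add (by norm_num)]
      ring_nf
    rw [mul_assoc, e1] at hLn
    rw [mul_assoc, e2] at hUn
    rw [dist_eq_norm, hsum, show A N - (A N + L + U) = -(L + U) by abel, norm_neg]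
    linarith [norm_add_le L U]
  have hsumm : Summable fun N => 2 * C₁ * θ₁ ^ N + C₂ * θ₂ ^ N :=
    ((summable_geometric_of_lt_one (by positivity) hθ₁').mul_left _).add
      ((summable_geometric_of_lt_one (by positivity) hθ₂').mul_left _)
  obtain ⟨A₀, hA₀⟩ := cauchySeq_tendsto_of_complete (cauchySeq_of_dist_le_of_summable _ hstep hsumm)
  -- the limit is `W g`, since multiplication by `W` is closed
  refine ⟨A₀, fun χ φ hφ => ?_,
    isCompactOperator_of_tendsto hA₀ (Eventually.of_forall hAc)⟩
  have h1 : ∀ N, ∃ ψ : L2 F,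
      IsMul (scalarMul F ((annulus N).indicator 1)) (fourierL2 φ) (fourierL2 ψ) := fun N =>
    exists_isMul_fourier (C := 1) (aestronglyMeasurable_scalarMul (F := F)
      (measurable_one.indicator (measurableSet_annulus N)))
      (Eventually.of_forall fun ξ => (norm_scalarMul_le _ ξ).trans
        (by by_cases hξ : ξ ∈ annulus N <;> simp [hξ])) φ
  choose ψ hψ using h1
  have hψlim : Tendsto ψ atTop (𝓝 φ) := tendsto_of_tendsto_fourierL2 (tendsto_indicator_mul hψ)
  have hAlim : Tendsto (fun N => A N χ) atTop (𝓝 (A₀ χ)) :=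
    ((ContinuousLinearMap.apply ℂ (L2 F) χ).continuous.tendsto _).comp hA₀
  refine IsMul.of_tendsto (fun N => hA N χ (ψ N) ?_) hψlim hAlim
  filter_upwards [hψ N, hφ] with ξ h2 h3
  rw [h2, h3]
  by_cases hξ : ξ ∈ annulus N <;> simp [scalarMul, ha, hξ]

end Weight

/-! ### The factorized Birman-Schwinger operator -/

section BirmanSchwinger

variable {F : Type} [NormedAddCommGroup F] [InnerProductSpace ℂ F]

theorem inner_eq_of_isMul {M M' : R3 → F →L[ℂ] F} {u v u' v' : L2 F} (h : IsMul M u u')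
    (h' : IsMul M' v v')
    (hM : ∀ᵐ x ∂(volume : Measure R3), ∀ y z : F, inner ℂ (M x y) z = inner ℂ y (M' x z)) :
    inner ℂ u' v = inner ℂ u v' := by
  rw [L2.inner_def, L2.inner_def]
  refine integral_congr_ae ?_
  filter_upwards [h, h', hM] with x h1 h2 h3
  rw [h1, h2, h3]

theorem inner_scalarMul (a : R3 → ℝ) (x : R3) (y z : F) :
    inner ℂ (scalarMul F a x y) z = inner ℂ y (scalarMul F a x z) := by
  simp [scalarMul]

theorem abs_indicator_one_le (N : ℕ) (ξ : R3) : |(annulus N).indicator (1 : R3 → ℝ) ξ| ≤ 1 := by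
  by_cases hξ : ξ ∈ annulus N <;> simp [hξ]

theorem abs_indicator_weight_le {b : ℝ} (hb : 0 ≤ b) (N : ℕ) (ξ : R3) :
    |(annulus N).indicator (weight b) ξ| ≤ 2 ^ N := by
  by_cases hξ : ξ ∈ annulus N
  · simpa [hξ, abs_of_nonneg (weight_nonneg b ξ)] using weight_le_of_mem_annulus hb hξ
  · simp [hξ]

theorem inv_weight_le_of_mem_annulus {b : ℝ} (hb : 0 ≤ b) {N : ℕ} {ξ : R3} (h : ξ ∈ annulus N) :
    (weight b ξ)⁻¹ ≤ ((2 : ℝ) ^ N) ^ b := by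
  have h1 : (1 : ℝ) ≤ (2 ^ N) := one_le_pow₀ (by norm_num)
  have h2 : 1 ≤ ((2 : ℝ) ^ N) ^ b := Real.one_le_rpow h1 hb
  unfold weight; split_ifs with h3
  · rw [inv_inv]; linarith
  · rw [Real.rpow_neg (norm_nonneg _), inv_inv]
    exact Real.rpow_le_rpow (norm_nonneg _) h.2.le hb

/-- The rescaled resolvent symbol `g⁻² (t - E)⁻¹`, where `r E` stands for `(t - E)⁻¹`. -/
def reducedResolvent (b : ℝ) (r : ℝ → R3 → F →L[ℂ] F) (E : ℝ) (ξ : R3) : F →L[ℂ] F :=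
  (((weight b ξ ^ 2)⁻¹ : ℝ) : ℂ) • r E ξ

theorem reducedResolvent_weight {b : ℝ} {r : ℝ → R3 → F →L[ℂ] F} {ξ : R3}
    (hξ : ξ ≠ 0) (E : ℝ) (v : F) :
    scalarMul F (weight b) ξ (reducedResolvent b r E ξ (scalarMul F (weight b) ξ v)) = r E ξ v := by
  have hw : (weight b ξ : ℂ) ≠ 0 := by exact_mod_cast (weight_pos b hξ).ne'
  simp only [scalarMul, reducedResolvent, smul_apply,
    ContinuousLinearMap.id_apply, map_smul, smul_smul]
  rw [show ((weight b ξ : ℂ)) * ((weight b ξ ^ 2)⁻¹ : ℝ) * (weight b ξ : ℂ) = 1 by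
    push_cast; field_simp, one_smul]

variable [CompleteSpace F]

theorem fourierL2_smul (c : ℂ) (u : L2 F) : fourierL2 (c • u) = c • fourierL2 u :=
  map_smul (Lp.fourierTransformₗᵢ R3 F) c u

theorem exists_indicator_fourier (N : ℕ) (χ : L2 F) :
    ∃ φ, IsMul (scalarMul F ((annulus N).indicator 1)) (fourierL2 χ) (fourierL2 φ) :=
  exists_isMul_fourier (C := 1) (aestronglyMeasurable_scalarMul
    (measurable_one.indicator (measurableSet_annulus N)))
    (Eventually.of_forall fun ξ => (norm_scalarMul_le _ ξ).trans (abs_indicator_one_le N ξ)) χ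

theorem exists_indicator_weight_fourier {b : ℝ} (hb : 0 ≤ b) (N : ℕ) (χ : L2 F) :
    ∃ φ, IsMul (scalarMul F ((annulus N).indicator (weight b))) (fourierL2 χ) (fourierL2 φ) :=
  exists_isMul_fourier (C := 2 ^ N) (aestronglyMeasurable_scalarMul
    ((measurable_weight b).indicator (measurableSet_annulus N)))
    (Eventually.of_forall fun ξ => (norm_scalarMul_le _ ξ).trans
      (abs_indicator_weight_le hb N ξ)) χ

/-- The adjoint of `W g` is identified on each annulus in momentum space by testing with functions
whose Fourier transform is supported there. -/
theorem IsProd.adjoint_indicator {W : R3 → F →L[ℂ] F} {b : ℝ} (hb : 0 ≤ b)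
    {A : L2 F →L[ℂ] L2 F} (hA : IsProd W (weight b) A) {u κ : L2 F} {N : ℕ}
    (h : ∀ η ψ w : L2 F,
      IsMul (scalarMul F ((annulus N).indicator (weight b))) (fourierL2 η) (fourierL2 ψ) →
      IsMul W ψ w → inner ℂ w u = inner ℂ (fourierL2 η) κ) :
    IsMul (scalarMul F ((annulus N).indicator 1))
      (fourierL2 (ContinuousLinearMap.adjoint A u)) κ := by
  obtain ⟨α, hα⟩ := exists_indicator_fourier N (ContinuousLinearMap.adjoint A u)
  suffices h' : fourierL2 α = κ from h' ▸ hα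
  refine ext_inner_left ℂ fun v => ?_
  obtain ⟨η, rfl⟩ := exists_fourierL2_eq v
  obtain ⟨ηN, hηN⟩ := exists_indicator_fourier N η
  obtain ⟨ψ, hψ⟩ := exists_indicator_weight_fourier hb N η
  have h1 : IsMul (scalarMul F (weight b)) (fourierL2 ηN) (fourierL2 ψ) := by
    filter_upwards [hηN, hψ] with ξ h1 h2
    rw [h1, h2]
    by_cases hξ : ξ ∈ annulus N <;> simp [scalarMul, hξ]
  rw [← h η ψ (A ηN) hψ (hA ηN ψ h1), ← ContinuousLinearMap.adjoint_inner_right,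
    ← inner_fourierL2 ηN]
  exact (inner_eq_of_isMul hηN hα (Eventually.of_forall fun ξ => inner_scalarMul _ ξ)).symm

/-- The annuli exhaust momentum space up to the null set `{0}`. -/
theorem ae_of_forall_annulus {P : R3 → Prop}
    (h : ∀ N, ∀ᵐ ξ ∂(volume : Measure R3), ξ ∈ annulus N → P ξ) :
    ∀ᵐ ξ ∂(volume : Measure R3), P ξ := by
  filter_upwards [ae_all_iff.2 h, ae_ne_zero] with ξ h1 h2
  obtain ⟨N, hN⟩ := (eventually_mem_annulus h2).exists
  exact h1 N hN

/-- The adjoint of `W g` is `g W`, on the domain of `W`. -/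
theorem IsProd.adjoint {W : R3 → F →L[ℂ] F} {b : ℝ} (hb : 0 ≤ b)
    (hWs : ∀ᵐ x ∂(volume : Measure R3), ∀ y z : F, inner ℂ (W x y) z = inner ℂ y (W x z))
    {A : L2 F →L[ℂ] L2 F} (hA : IsProd W (weight b) A) {u f : L2 F} (hf : IsMul W u f) :
    IsMul (scalarMul F (weight b)) (fourierL2 f) (fourierL2 (ContinuousLinearMap.adjoint A u)) := by
  refine ae_of_forall_annulus fun N => ?_
  obtain ⟨κ, hκ⟩ := exists_indicator_weight_fourier hb N f
  have h1 := hA.adjoint_indicator hb (u := u) (κ := fourierL2 κ) (N := N) fun η ψ w hψ hw => by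
    rw [inner_eq_of_isMul hw hf hWs, ← inner_fourierL2]
    exact inner_eq_of_isMul hψ hκ (Eventually.of_forall fun ξ => inner_scalarMul _ ξ)
  filter_upwards [h1, hκ] with ξ h1 h2 hξ
  simpa [scalarMul, hξ, h2] using h1.symm

/-- The bounded operator with Fourier symbol `M`. -/
theorem exists_fourierMultiplier {M : R3 → F →L[ℂ] F} {C : ℝ} (hC0 : 0 ≤ C)
    (hM : AEStronglyMeasurable M volume)
    (hC : ∀ᵐ x ∂(volume : Measure R3), ‖M x‖ ≤ C) :
    ∃ T : L2 F →L[ℂ] L2 F, (∀ χ, IsMul M (fourierL2 χ) (fourierL2 (T χ))) ∧ ‖T‖ ≤ C := by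
  set U : L2 F →L[ℂ] L2 F := (Lp.fourierTransformₗᵢ R3 F).toLinearIsometry.toContinuousLinearMap
    with hU
  set U' : L2 F →L[ℂ] L2 F :=
    (Lp.fourierTransformₗᵢ R3 F).symm.toLinearIsometry.toContinuousLinearMap with hU'
  have key : ∀ χ, IsMul M (fourierL2 χ) (fourierL2 ((U' ∘L mulOp M C hM hC ∘L U) χ)) := fun χ => by
    have h1 : fourierL2 ((U' ∘L mulOp M C hM hC ∘L U) χ) = mulOp M C hM hC (fourierL2 χ) :=
      (Lp.fourierTransformₗᵢ R3 F).apply_symm_apply _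
    rw [h1]
    exact isMul_mulOp hM hC _
  refine ⟨U' ∘L mulOp M C hM hC ∘L U, key, ContinuousLinearMap.opNorm_le_bound _ hC0 fun u => ?_⟩
  rw [← norm_fourierL2, ← norm_fourierL2 u]
  exact (key u).norm_le hC

/-- `r E` is the symbol (as a function of `ξ = p / (2π)`) of the resolvent `(T - E)⁻¹` for `E` in the spectral gap `I`, extended to
the set `J` of energies, which adds the thresholds. The resolvents are dominated by the square of
the momentum weight, uniformly in the energy; in the gap `I` each of them is bounded. -/
structure IsResolventFamily (t : R3 → F →L[ℂ] F) (b C : ℝ) (I J : Set ℝ)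
    (r : ℝ → R3 → F →L[ℂ] F) : Prop where
  exponent_nonneg : 0 ≤ b
  const_nonneg : 0 ≤ C
  subset : I ⊆ J
  symbol_meas : AEStronglyMeasurable (symbolAt t) volume
  symbol_bdd : ∀ N, ∃ c, ∀ ξ ∈ annulus N, ‖symbolAt t ξ‖ ≤ c
  meas : ∀ E ∈ J, AEStronglyMeasurable (r E) volume
  bound : ∀ E ∈ J, ∀ ξ ≠ 0, ‖r E ξ‖ ≤ C * weight b ξ ^ 2
  bdd : ∀ E ∈ I, ∃ c, ∀ ξ, ‖r E ξ‖ ≤ c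
  left_inv : ∀ E ∈ I, ∀ ξ v, r E ξ (symbolAt t ξ v - (E : ℂ) • v) = v
  right_inv : ∀ E ∈ I, ∀ ξ v, symbolAt t ξ (r E ξ v) - (E : ℂ) • r E ξ v = v
  tendsto : ∀ E₀ ∈ J, ∀ ξ ≠ 0, Tendsto (fun E => r E ξ) (𝓝[J] E₀) (𝓝 (r E₀ ξ))

/-- For every energy `E` in `J`, the thresholds included, `M E` is the Fourier multiplier with symbol
`g⁻² (t - E)⁻¹`, and its norm is at most `C`. -/
def IsReducedFamily (b C : ℝ) (J : Set ℝ) (r : ℝ → R3 → F →L[ℂ] F) (M : ℝ → L2 F →L[ℂ] L2 F) :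
    Prop :=
  ∀ E ∈ J, (∀ χ, IsMul (reducedResolvent b r E) (fourierL2 χ) (fourierL2 (M E χ))) ∧ ‖M E‖ ≤ C

variable {t : R3 → F →L[ℂ] F} {b C : ℝ} {I J : Set ℝ} {r : ℝ → R3 → F →L[ℂ] F}

theorem IsResolventFamily.norm_reducedResolvent_le (hr : IsResolventFamily t b C I J r) {E : ℝ}
    (hE : E ∈ J) : ∀ᵐ ξ ∂(volume : Measure R3), ‖reducedResolvent b r E ξ‖ ≤ C := by
  filter_upwards [ae_ne_zero] with ξ hξ
  have hw := weight_pos b hξ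
  rw [reducedResolvent, norm_smul, Complex.norm_real, Real.norm_of_nonneg (by positivity),
    inv_mul_le_iff₀ (by positivity), mul_comm]
  exact hr.bound E hE ξ hξ

theorem IsResolventFamily.exists_isReducedFamily (hr : IsResolventFamily t b C I J r) :
    ∃ M, IsReducedFamily b C J r M := by
  have : ∀ E, ∃ T : L2 F →L[ℂ] L2 F, E ∈ J →
      (∀ χ, IsMul (reducedResolvent b r E) (fourierL2 χ) (fourierL2 (T χ))) ∧ ‖T‖ ≤ C := fun E => by
    by_cases hE : E ∈ J
    · obtain ⟨T, hT⟩ := exists_fourierMultiplier (M := reducedResolvent b r E) hr.const_nonneg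
        ((Complex.measurable_ofReal.comp
          (((measurable_weight b).pow_const 2).inv)).aestronglyMeasurable.smul (hr.meas E hE))
        (hr.norm_reducedResolvent_le hE)
      exact ⟨T, fun _ => hT⟩
    · exact ⟨0, fun h => absurd h hE⟩
  choose M hM using this
  exact ⟨M, hM⟩

variable {W : R3 → F →L[ℂ] F} {A : L2 F →L[ℂ] L2 F} {M : ℝ → L2 F →L[ℂ] L2 F}

/-- The Birman-Schwinger operator in the factorized form `(W g) (g⁻² (T - E)⁻¹) (W g)^*`, where
`A = W g` and `M E = g⁻² (T - E)⁻¹`. It makes sense at the thresholds as well. -/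
def bsOp (A : L2 F →L[ℂ] L2 F) (M : ℝ → L2 F →L[ℂ] L2 F) (E : ℝ) : L2 F →L[ℂ] L2 F :=
  A ∘L M E ∘L ContinuousLinearMap.adjoint A

theorem isCompactOperator_bsOp (hAc : IsCompactOperator A) (E : ℝ) :
    IsCompactOperator (bsOp A M E) :=
  hAc.comp_clm (M E ∘L ContinuousLinearMap.adjoint A)

/-- The reduced resolvents converge strongly, hence the Birman-Schwinger operators converge in
norm. -/
theorem tendsto_bsOp (hr : IsResolventFamily t b C I J r) (hM : IsReducedFamily b C J r M)
    (hAc : IsCompactOperator A) {E₀ : ℝ} (hE₀ : E₀ ∈ J) :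
    Tendsto (bsOp A M) (𝓝[J] E₀) (𝓝 (bsOp A M E₀)) := by
  have h1 : Tendsto (fun E => M E ∘L ContinuousLinearMap.adjoint A) (𝓝[J] E₀)
      (𝓝 (M E₀ ∘L ContinuousLinearMap.adjoint A)) := by
    refine tendsto_comp_of_isCompactOperator (C := C) ?_ (fun v => ?_) hAc.hilbert_adjoint
    · filter_upwards [self_mem_nhdsWithin] with E hE using (hM E hE).2
    · refine tendsto_of_tendsto_fourierL2 (tendsto_of_isMul (M := reducedResolvent b r)
        (C := C) ?_ ?_ ?_ ((hM E₀ hE₀).1 v))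
      · filter_upwards [self_mem_nhdsWithin] with E hE using hr.norm_reducedResolvent_le hE
      · filter_upwards [ae_ne_zero] with ξ hξ
        exact (hr.tendsto E₀ hE₀ ξ hξ).const_smul _
      · filter_upwards [self_mem_nhdsWithin] with E hE using (hM E hE).1 v
  exact ((ContinuousLinearMap.compL ℂ (L2 F) (L2 F) (L2 F) A).continuous.tendsto _).comp h1

/-- The factorized operator agrees with the product `W (T - E)⁻¹ W` wherever the latter is defined. -/
theorem mul_resolvent_eq_bsOp (hr : IsResolventFamily t b C I J r) (hM : IsReducedFamily b C J r M)
    (hWs : ∀ᵐ x ∂(volume : Measure R3), ∀ y z : F, inner ℂ (W x y) z = inner ℂ y (W x z))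
    (hA : IsProd W (weight b) A) {E : ℝ} (hE : E ∈ J) {u f φ : L2 F} (hf : IsMul W u f)
    (hφ : IsMul (r E) (fourierL2 f) (fourierL2 φ)) : IsMul W φ (bsOp A M E u) := by
  refine hA (M E (ContinuousLinearMap.adjoint A u)) φ ?_
  filter_upwards [hφ, hA.adjoint hr.exponent_nonneg hWs hf,
    (hM E hE).1 (ContinuousLinearMap.adjoint A u), ae_ne_zero] with ξ h1 h2 h3 h4
  rw [h1, h3, h2, reducedResolvent_weight h4]

/-- The factorized operator is the closure of `W (T - E)⁻¹ W`: it extends this product, and the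
functions `u` supported where `W` is bounded are dense and lie in the domain of the product. -/
theorem isBirmanSchwinger_bsOp (hr : IsResolventFamily t b C I J r)
    (hM : IsReducedFamily b C J r M) (hW : AEStronglyMeasurable W volume)
    (hWs : ∀ᵐ x ∂(volume : Measure R3), ∀ y z : F, inner ℂ (W x y) z = inner ℂ y (W x z))
    (hA : IsProd W (weight b) A) {E : ℝ} (hE : E ∈ I) :
    IsBirmanSchwinger t W E (bsOp A M E) := by
  have hEJ := hr.subset hE
  have hkin : ∀ f φ : L2 F, IsKinetic t φ (f + (E : ℂ) • φ) ↔
      IsMul (r E) (fourierL2 f) (fourierL2 φ) := by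
    intro f φ
    unfold IsKinetic
    rw [fourierL2_add, fourierL2_smul]
    refine eventually_congr ?_
    filter_upwards [Lp.coeFn_add (fourierL2 f) ((E : ℂ) • fourierL2 φ),
      Lp.coeFn_smul (E : ℂ) (fourierL2 φ)] with ξ h1 h2
    rw [h1, Pi.add_apply, h2, Pi.smul_apply]
    constructor
    · intro h3
      rw [eq_sub_of_add_eq h3, hr.left_inv E hE]
    · intro h3
      have h4 := hr.right_inv E hE ξ (fourierL2 f ξ)
      rw [← h3] at h4
      rw [← h4, sub_add_cancel]
  refine subset_antisymm (closure_minimal ?_ ?_) ?_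
  · rintro ⟨u, w⟩ ⟨f, φ, hf, hφ, hw⟩
    exact hw.unique (mul_resolvent_eq_bsOp hr hM hWs hA hEJ hf ((hkin f φ).1 hφ))
  · exact isClosed_eq continuous_snd ((bsOp A M E).continuous.comp continuous_fst)
  · rintro ⟨u, w⟩ h
    obtain rfl : w = bsOp A M E u := h
    -- cut off `u` where `W` is large
    set s : ℕ → Set R3 := fun n => {x | ‖W x‖ ≤ n} with hs
    have hsm : ∀ n, NullMeasurableSet (s n) volume := fun n =>
      nullMeasurableSet_le hW.norm.aemeasurable aemeasurable_const
    set Q : ℕ → R3 → F →L[ℂ] F := fun n => (s n).indicator fun _ => ContinuousLinearMap.id ℂ F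
      with hQ
    have hQm : ∀ n, AEStronglyMeasurable (Q n) volume := fun n =>
      aestronglyMeasurable_const.indicator₀ (hsm n)
    have hQb : ∀ n, ∀ᵐ x ∂(volume : Measure R3), ‖Q n x‖ ≤ 1 := fun n =>
      Eventually.of_forall fun x => by
        by_cases hx : x ∈ s n
        · rw [hQ]; simp only [Set.indicator_of_mem hx]; exact ContinuousLinearMap.norm_id_le
        · rw [hQ]; simp only [Set.indicator_of_notMem hx]; simp
    have hQW : ∀ n, ∀ᵐ x ∂(volume : Measure R3), ‖(s n).indicator W x‖ ≤ n := fun n =>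
      Eventually.of_forall fun x => by
        by_cases hx : x ∈ s n
        · rw [Set.indicator_of_mem hx]; exact hx
        · rw [Set.indicator_of_notMem hx]; simp
    set u' : ℕ → L2 F := fun n => mulOp (Q n) 1 (hQm n) (hQb n) u with hu'
    have hu'm : ∀ n, IsMul (Q n) u (u' n) := fun n => isMul_mulOp _ _ _
    have hlim : Tendsto u' atTop (𝓝 u) := by
      refine tendsto_of_isMul (C := 1) (M₀ := fun _ => ContinuousLinearMap.id ℂ F)
        (Eventually.of_forall hQb) (Eventually.of_forall fun x => ?_) (Eventually.of_forall hu'm)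
        (Eventually.of_forall fun x => rfl)
      refine tendsto_const_nhds.congr' ?_
      filter_upwards [eventually_ge_atTop ⌈‖W x‖⌉₊] with n hn
      rw [hQ]
      exact (Set.indicator_of_mem (show x ∈ s n from Nat.ceil_le.1 hn)
        (fun _ => ContinuousLinearMap.id ℂ F)).symm
    refine mem_closure_of_tendsto
      (hlim.prodMk_nhds (((bsOp A M E).continuous.tendsto u).comp hlim))
      (Eventually.of_forall fun n => ?_)
    have hf : IsMul W (u' n) (mulOp ((s n).indicator W) n (hW.indicator₀ (hsm n)) (hQW n) u) := by
      filter_upwards [hu'm n, isMul_mulOp (hW.indicator₀ (hsm n)) (hQW n) u] with x h1 h2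
      rw [h1, h2, hQ]
      by_cases hx : x ∈ s n <;> simp [hx]
    obtain ⟨c, hc⟩ := hr.bdd E hE
    obtain ⟨φ, hφ⟩ := exists_isMul_fourier (hr.meas E hEJ) (Eventually.of_forall hc)
      (mulOp ((s n).indicator W) n (hW.indicator₀ (hsm n)) (hQW n) u)
    exact ⟨_, φ, hf, (hkin _ φ).2 hφ, mul_resolvent_eq_bsOp hr hM hWs hA hEJ hf hφ⟩

end BirmanSchwinger

/-! ### The eigenvalue equation at the threshold -/

section Eigenfunctions

variable {F : Type} [NormedAddCommGroup F] [InnerProductSpace ℂ F] [CompleteSpace F]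
  {t : R3 → F →L[ℂ] F} {b C : ℝ} {I J : Set ℝ} {r : ℝ → R3 → F →L[ℂ] F}
  {W : R3 → F →L[ℂ] F} {A : L2 F →L[ℂ] L2 F} {M : ℝ → L2 F →L[ℂ] L2 F}

/-- The eigenvalue equation in the form `φ̂ = g · g⁻² (t - E)⁻¹ · λ (W g)^* μ`, `μ = W φ`. It is
derived by testing with functions `ψ` such that `ψ̂` is supported in an annulus. -/
theorem SolvesEigenEq.fourier_eq (hr : IsResolventFamily t b C I J r)
    (hM : IsReducedFamily b C J r M) (hA : IsProd W (weight b) A) {E lam : ℝ} (hE : E ∈ I)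
    {φ μ : L2 F} (h : SolvesEigenEq t W lam E φ) (hμ : IsMul W φ μ) :
    IsMul (scalarMul F (weight b))
      (fourierL2 (M E (ContinuousLinearMap.adjoint A ((lam : ℂ) • μ)))) (fourierL2 φ) := by
  have key : ∀ᵐ ξ ∂(volume : Measure R3),
      fourierL2 (ContinuousLinearMap.adjoint A ((lam : ℂ) • μ)) ξ =
        scalarMul F (weight b) ξ (symbolAt t ξ (fourierL2 φ ξ) - (E : ℂ) • fourierL2 φ ξ) := by
    refine ae_of_forall_annulus fun N => ?_
    obtain ⟨c, hc⟩ := hr.symbol_bdd N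
    set a : R3 → ℝ := (annulus N).indicator (weight b) with ha
    have ham : AEStronglyMeasurable (scalarMul F a) volume := aestronglyMeasurable_scalarMul
      ((measurable_weight b).indicator (measurableSet_annulus N))
    -- `1_N g t φ̂` and `1_N g φ̂` as elements of `L₂`
    have hbd : ∀ ξ, ‖scalarMul F a ξ ∘L symbolAt t ξ‖ ≤ 2 ^ N * |c| := fun ξ => by
      by_cases hξ : ξ ∈ annulus N
      · refine (ContinuousLinearMap.opNorm_comp_le _ _).trans ?_
        gcongr
        · exact (norm_scalarMul_le _ _).trans (abs_indicator_weight_le hr.exponent_nonneg N ξ)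
        · exact (hc ξ hξ).trans (le_abs_self c)
      · have : scalarMul F a ξ = 0 := by simp [scalarMul, ha, hξ]
        rw [this, ContinuousLinearMap.zero_comp, norm_zero]
        positivity
    obtain ⟨κ₁, hκ₁⟩ := exists_isMul_fourier
      ((ContinuousLinearMap.compL ℂ F F F).aestronglyMeasurable_comp₂ ham hr.symbol_meas)
      (Eventually.of_forall hbd) φ
    obtain ⟨κ₂, hκ₂⟩ := exists_indicator_weight_fourier hr.exponent_nonneg N φ
    have h1 := hA.adjoint_indicator hr.exponent_nonneg (u := (lam : ℂ) • μ)
      (κ := fourierL2 κ₁ - (E : ℂ) • fourierL2 κ₂) (N := N) fun η ψ w hψ hw => by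
        have hform : InFormDomain t W ψ := by
          refine ⟨?_, (Lp.memLp w).ae_eq hw⟩
          refine ((integrable_norm_sq (fourierL2 ψ)).const_mul |c|).mono'
            (hr.symbol_meas.norm.mul ((Lp.aestronglyMeasurable _).norm.pow 2)) ?_
          filter_upwards [hψ] with ξ h1
          rw [Real.norm_of_nonneg (by positivity)]
          by_cases hξ : ξ ∈ annulus N
          · gcongr
            exact (hc ξ hξ).trans (le_abs_self c)
          · have : fourierL2 ψ ξ = 0 := by rw [h1]; simp [scalarMul, hξ]
            rw [this]; simp
        have h2 := h.2 ψ hform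
        have h3 : ∫ ξ, inner ℂ (fourierL2 ψ ξ) (symbolAt t ξ (fourierL2 φ ξ)) =
            inner ℂ (fourierL2 η) (fourierL2 κ₁) := by
          rw [L2.inner_def]
          refine integral_congr_ae ?_
          filter_upwards [hψ, hκ₁] with ξ h4 h5
          rw [h4, inner_scalarMul, h5]
          rfl
        have h4 : ∫ x, inner ℂ (W x (ψ x)) (W x (φ x)) = inner ℂ w μ := by
          rw [L2.inner_def]
          refine integral_congr_ae ?_
          filter_upwards [hw, hμ] with x h4 h5
          rw [h4, h5]
        have h5 : inner ℂ ψ φ = inner ℂ (fourierL2 η) (fourierL2 κ₂) := by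
          rw [← inner_fourierL2]
          exact inner_eq_of_isMul hψ hκ₂ (Eventually.of_forall fun ξ => inner_scalarMul _ ξ)
        rw [h3, h4, h5] at h2
        rw [inner_smul_right, inner_sub_right, inner_smul_right, ← h2]
        ring
    filter_upwards [h1, hκ₁, hκ₂, Lp.coeFn_sub (fourierL2 κ₁) ((E : ℂ) • fourierL2 κ₂),
      Lp.coeFn_smul (E : ℂ) (fourierL2 κ₂)] with ξ h1 h2 h3 h4 h5 hξ
    rw [h4, Pi.sub_apply, h5, Pi.smul_apply, h2, h3] at h1
    have h6 : scalarMul F a ξ = scalarMul F (weight b) ξ := by simp [scalarMul, ha, hξ]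
    rw [show (annulus N).indicator (weight b) = a from rfl, ContinuousLinearMap.compL_apply,
      ContinuousLinearMap.comp_apply, h6] at h1
    rw [map_sub, (scalarMul F (weight b) ξ).map_smul, h1]
    simp [scalarMul, hξ]
  filter_upwards [key, (hM E (hr.subset hE)).1 (ContinuousLinearMap.adjoint A ((lam : ℂ) • μ)),
    ae_ne_zero] with ξ h1 h2 h3
  rw [h2, h1, reducedResolvent_weight h3, hr.left_inv E hE]

/-- The Birman-Schwinger principle. -/
theorem SolvesEigenEq.bsOp_eq (hr : IsResolventFamily t b C I J r)
    (hM : IsReducedFamily b C J r M) (hA : IsProd W (weight b) A) {E lam : ℝ} (hE : E ∈ I)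
    {φ μ : L2 F} (h : SolvesEigenEq t W lam E φ) (hμ : IsMul W φ μ) :
    μ = (lam : ℂ) • bsOp A M E μ := by
  rw [← map_smul]
  exact hμ.unique (hA _ _ (h.fourier_eq hr hM hA hE hμ))

theorem SolvesEigenEq.ne_zero (hr : IsResolventFamily t b C I J r)
    (hM : IsReducedFamily b C J r M) (hA : IsProd W (weight b) A) {E lam : ℝ} (hE : E ∈ I)
    {φ μ : L2 F} (h : SolvesEigenEq t W lam E φ) (hμ : IsMul W φ μ) (hφ : φ ≠ 0) : μ ≠ 0 := by
  rintro rfl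
  refine hφ (fourierL2_injective ?_)
  have h1 := h.fourier_eq hr hM hA hE hμ
  rw [smul_zero, map_zero, map_zero] at h1
  refine h1.unique ?_
  have h2 : fourierL2 (0 : L2 F) = 0 := map_zero (Lp.fourierTransformₗᵢ R3 F)
  rw [h2]
  filter_upwards [Lp.coeFn_zero F 2 (volume : Measure R3)] with ξ h3
  rw [h3]; simp

/-- Cutting off small and large momenta changes the range of the adjoint of a compact operator
only little, uniformly on bounded sets. -/
theorem exists_annulus_approx (hAc : IsCompactOperator A) {δ : ℝ} (hδ : 0 < δ) :
    ∃ (N : ℕ) (P : L2 F →L[ℂ] L2 F),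
      (∀ χ, IsMul (scalarMul F ((annulus N).indicator 1)) (fourierL2 χ) (fourierL2 (P χ))) ∧
      ∀ v, ‖ContinuousLinearMap.adjoint A v - P (ContinuousLinearMap.adjoint A v)‖ ≤ δ * ‖v‖ := by
  have hP : ∀ N, ∃ P : L2 F →L[ℂ] L2 F,
      (∀ χ, IsMul (scalarMul F ((annulus N).indicator 1)) (fourierL2 χ) (fourierL2 (P χ))) ∧
        ‖P‖ ≤ 1 := fun N =>
    exists_fourierMultiplier zero_le_one (aestronglyMeasurable_scalarMul
      (measurable_one.indicator (measurableSet_annulus N)))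
      (Eventually.of_forall fun ξ => (norm_scalarMul_le _ ξ).trans (abs_indicator_one_le N ξ))
  choose P hP hP1 using hP
  have hPlim : ∀ v, Tendsto (fun N => P N v) atTop (𝓝 v) := fun v =>
    tendsto_of_tendsto_fourierL2 (tendsto_indicator_mul fun N => hP N v)
  have hlim : Tendsto (fun N => P N ∘L ContinuousLinearMap.adjoint A) atTop
      (𝓝 (ContinuousLinearMap.id ℂ (L2 F) ∘L ContinuousLinearMap.adjoint A)) :=
    tendsto_comp_of_isCompactOperator (C := 1) (Eventually.of_forall hP1)
      (fun v => by rw [ContinuousLinearMap.id_apply]; exact hPlim v) hAc.hilbert_adjoint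
  obtain ⟨N, hN⟩ := Metric.tendsto_atTop.1 hlim δ hδ
  replace hN := (hN N le_rfl).le
  rw [dist_eq_norm, norm_sub_rev] at hN
  exact ⟨N, P N, hP N, fun v => ContinuousLinearMap.le_of_opNorm_le _ hN v⟩

/-- The norm of `W φ` is controlled by that of `φ` for eigenfunctions `φ`, uniformly in the energy:
the contribution of momenta in an annulus is bounded by `‖φ‖`, and that of the other momenta is a
small multiple of `‖W φ‖` since `W g` is compact. -/
theorem exists_norm_le_of_solvesEigenEq (hr : IsResolventFamily t b C I J r)
    (hM : IsReducedFamily b C J r M) (hA : IsProd W (weight b) A) (hAc : IsCompactOperator A)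
    (L : ℝ) : ∃ D, ∀ E ∈ I, ∀ lam : ℝ, |lam| ≤ L → ∀ φ μ : L2 F,
      SolvesEigenEq t W lam E φ → IsMul W φ μ → ‖μ‖ ≤ D * ‖φ‖ := by
  rcases lt_or_ge L 0 with hL | hL
  · exact ⟨0, fun E _ lam hlam => absurd ((abs_nonneg lam).trans hlam) (not_le.2 hL)⟩
  have hC := hr.const_nonneg
  obtain ⟨δ, hδ0, h8⟩ : ∃ δ : ℝ, 0 < δ ∧ ‖A‖ * C * L * δ ≤ 1 / 2 := by
    refine ⟨1 / (2 * (‖A‖ * C * L + 1)), by positivity, ?_⟩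
    rw [mul_one_div, div_le_div_iff₀ (by positivity) (by norm_num)]
    linarith
  obtain ⟨N, P, hP, hN⟩ := exists_annulus_approx hAc hδ0
  refine ⟨2 * (‖A‖ * ((2 : ℝ) ^ N) ^ b), fun E hE lam hlam φ μ h hμ => ?_⟩
  obtain ⟨hME, hMC⟩ := hM E (hr.subset hE)
  have h1 := h.fourier_eq hr hM hA hE hμ
  have h5 := hN ((lam : ℂ) • μ)
  generalize ContinuousLinearMap.adjoint A ((lam : ℂ) • μ) = ν at h1 h5
  rw [norm_smul, Complex.norm_real, Real.norm_eq_abs] at h5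
  replace h5 : ‖ν - P ν‖ ≤ δ * (L * ‖μ‖) := h5.trans (by gcongr)
  have h2 : μ = A (M E ν) := hμ.unique (hA _ _ h1)
  -- the part of `M E ν = g⁻¹ φ̂` with momenta in the annulus
  have h3 : ‖P (M E ν)‖ ≤ ((2 : ℝ) ^ N) ^ b * ‖φ‖ := by
    rw [← norm_fourierL2, ← norm_fourierL2 φ]
    refine Lp.norm_le_mul_norm_of_ae_le_mul ?_
    filter_upwards [hP (M E ν), h1, ae_ne_zero] with ξ h4 h5 h6
    by_cases hξ : ξ ∈ annulus N
    · have hw := weight_pos b h6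
      rw [h4, h5]
      simp only [scalarMul, hξ, Set.indicator_of_mem, Pi.one_apply, smul_apply,
        ContinuousLinearMap.id_apply, Complex.ofReal_one, one_smul, norm_smul,
        Complex.norm_real, Real.norm_of_nonneg hw.le]
      rw [← mul_assoc]
      refine le_mul_of_one_le_left (norm_nonneg _) ?_
      rw [← inv_mul_cancel₀ hw.ne']
      gcongr
      exact inv_weight_le_of_mem_annulus hr.exponent_nonneg hξ
    · rw [h4]
      simp [scalarMul, hξ]
      positivity
  -- the Fourier multipliers `P` and `M E` commute
  have h4 : M E ν - P (M E ν) = M E (ν - P ν) := by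
    rw [map_sub]
    congr 1
    refine fourierL2_injective (Lp.ext ?_)
    filter_upwards [hP (M E ν), hP ν, hME ν, hME (P ν)] with ξ h5 h6 h7 h8
    rw [h5, h7, h8, h6]
    simp [scalarMul]
  have h6 : ‖μ‖ ≤ ‖A‖ * (((2 : ℝ) ^ N) ^ b * ‖φ‖) + ‖A‖ * (C * (δ * (L * ‖μ‖))) := by
    calc ‖μ‖ = ‖A (P (M E ν)) + A (M E (ν - P ν))‖ := by
          rw [← map_add, ← h4, add_sub_cancel, ← h2]
      _ ≤ ‖A (P (M E ν))‖ + ‖A (M E (ν - P ν))‖ := norm_add_le _ _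
      _ ≤ _ := by
          gcongr
          · exact A.le_opNorm_of_le h3
          · exact A.le_opNorm_of_le ((ContinuousLinearMap.le_of_opNorm_le _ hMC _).trans (by gcongr))
  have h7 : ‖A‖ * (C * (δ * (L * ‖μ‖))) ≤ 1 / 2 * ‖μ‖ := by
    calc ‖A‖ * (C * (δ * (L * ‖μ‖))) = (‖A‖ * C * L * δ) * ‖μ‖ := by ring
      _ ≤ _ := by gcongr
  linarith

/-- Passing to the limit in `μ_n = λ_n K_{E_n} μ_n`: the `μ_n` are bounded, hence the `K_{E₀} μ_n`
converge along a subsequence, and `K_{E_n} - K_{E₀}` is small in norm. -/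
theorem eigenfunctionsConverge_bsOp (hr : IsResolventFamily t b C I J r)
    (hM : IsReducedFamily b C J r M) (hA : IsProd W (weight b) A) (hAc : IsCompactOperator A)
    {E₀ : ℝ} (hE₀ : E₀ ∈ J) : EigenfunctionsConverge t W I E₀ (bsOp A M E₀) := by
  intro lamc lam E φ μ hs
  have hEJ : Tendsto E atTop (𝓝[J] E₀) := tendsto_nhdsWithin_iff.2
    ⟨hs.energy_tendsto, Eventually.of_forall fun n => hr.subset (hs.energy_mem n)⟩
  have hK : Tendsto (fun n => bsOp A M (E n)) atTop (𝓝 (bsOp A M E₀)) :=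
    (tendsto_bsOp hr hM hAc hE₀).comp hEJ
  have heq : ∀ n, μ n = (lam n : ℂ) • bsOp A M (E n) (μ n) := fun n =>
    (hs.eigen n).bsOp_eq hr hM hA (hs.energy_mem n) (hs.birmanSchwinger n)
  have hφ0 : ∀ n, φ n ≠ 0 := fun n h => by simpa [h] using hs.normalized n
  have hμ0 : ∀ n, μ n ≠ 0 := fun n =>
    (hs.eigen n).ne_zero hr hM hA (hs.energy_mem n) (hs.birmanSchwinger n) (hφ0 n)
  -- `λ_n → 0` would force `μ_n = 0` for large `n`
  have hlamc : lamc ≠ 0 := by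
    rintro rfl
    have h1 : Tendsto (fun n => |lam n| * ‖bsOp A M (E n)‖) atTop (𝓝 (|0| * ‖bsOp A M E₀‖)) :=
      hs.coupling_tendsto.abs.mul hK.norm
    rw [abs_zero, zero_mul] at h1
    obtain ⟨n, hn⟩ := (h1.eventually_lt_const one_pos).exists
    have h2 : ‖μ n‖ ≤ |lam n| * ‖bsOp A M (E n)‖ * ‖μ n‖ := by
      conv_lhs => rw [heq n, norm_smul, Complex.norm_real, Real.norm_eq_abs]
      rw [mul_assoc]
      gcongr
      exact ContinuousLinearMap.le_opNorm _ _
    have h3 := norm_pos_iff.2 (hμ0 n)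
    nlinarith
  refine ⟨hlamc, ?_⟩
  obtain ⟨L, hL⟩ := hs.coupling_tendsto.abs.bddAbove_range
  obtain ⟨D, hD⟩ := exists_norm_le_of_solvesEigenEq hr hM hA hAc L
  have hμD : ∀ n, ‖μ n‖ ≤ D := fun n => by
    have := hD (E n) (hs.energy_mem n) (lam n) (hL ⟨n, rfl⟩) (φ n) (μ n) (hs.eigen n)
      (hs.birmanSchwinger n)
    rwa [hs.normalized n, mul_one] at this
  have hcomp : IsCompact (closure (bsOp A M E₀ '' Metric.closedBall 0 D)) :=
    (isCompactOperator_bsOp (M := M) hAc E₀).isCompact_closure_image_closedBall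
      (f := (bsOp A M E₀ : L2 F →ₗ[ℂ] L2 F)) D
  obtain ⟨ν, -, k, hk, hν⟩ := hcomp.tendsto_subseq (x := fun n => bsOp A M E₀ (μ n)) fun n =>
    subset_closure ⟨μ n, by simpa using hμD n, rfl⟩
  have hdiff : Tendsto (fun n => (bsOp A M (E n) - bsOp A M E₀) (μ n)) atTop (𝓝 0) := by
    have h1 : Tendsto (fun n => ‖bsOp A M (E n) - bsOp A M E₀‖ * D) atTop (𝓝 0) := by
      simpa using (tendsto_iff_norm_sub_tendsto_zero.1 hK).mul_const D
    exact squeeze_zero_norm (fun n => ContinuousLinearMap.le_opNorm_of_le _ (hμD n)) h1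
  have h2 : Tendsto (fun j => bsOp A M (E (k j)) (μ (k j))) atTop (𝓝 ν) := by
    have h3 := (hdiff.comp hk.tendsto_atTop).add hν
    rw [zero_add] at h3
    refine h3.congr fun j => ?_
    simp
  have h4 : Tendsto (fun j => μ (k j)) atTop (𝓝 ((lamc : ℂ) • ν)) := by
    have h5 : Tendsto (fun j => ((lam (k j) : ℝ) : ℂ)) atTop (𝓝 (lamc : ℂ)) :=
      (Complex.continuous_ofReal.tendsto _).comp (hs.coupling_tendsto.comp hk.tendsto_atTop)
    exact (h5.smul h2).congr fun j => (heq (k j)).symm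
  refine ⟨k, (lamc : ℂ) • ν, hk, h4, ?_⟩
  have h5 := tendsto_nhds_unique (((bsOp A M E₀).continuous.tendsto _).comp h4) hν
  rw [h5, smul_smul, ← Complex.ofReal_mul, inv_mul_cancel₀ hlamc, Complex.ofReal_one, one_smul]

/-- The conclusion for an abstract kinetic energy whose resolvent is dominated by the square of
the momentum weight. -/
theorem exists_birmanSchwinger_family [FiniteDimensional ℂ F] (hr : IsResolventFamily t b C I J r)
    (hW : AEStronglyMeasurable W volume)
    (hWs : ∀ᵐ x ∂(volume : Measure R3), ∀ y z : F, inner ℂ (W x y) z = inner ℂ y (W x z))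
    {p₁ p₂ : ℝ} (hp₁ : 2 ≤ p₁) (hp₁' : p₁ < 3) (hp₂ : 2 ≤ p₂) (hp₂b : 3 < p₂ * b)
    (hW₁ : Integrable (fun x => ‖W x‖ ^ p₁) volume)
    (hW₂ : Integrable (fun x => ‖W x‖ ^ p₂) volume) :
    ∃ K : ℝ → L2 F →L[ℂ] L2 F, (∀ E ∈ I, IsBirmanSchwinger t W E (K E)) ∧
      (∀ E, IsCompactOperator (K E)) ∧ (∀ E₀ ∈ J, Tendsto K (𝓝[J] E₀) (𝓝 (K E₀))) ∧
      ∀ E₀ ∈ J, EigenfunctionsConverge t W I E₀ (K E₀) := by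
  obtain ⟨A, hA, hAc⟩ := exists_isProd_weight hW hr.exponent_nonneg hp₁ hp₁' hp₂ hp₂b hW₁ hW₂
  obtain ⟨M, hM⟩ := hr.exists_isReducedFamily
  exact ⟨bsOp A M, fun E hE => isBirmanSchwinger_bsOp hr hM hW hWs hA hE,
    isCompactOperator_bsOp hAc, fun E₀ => tendsto_bsOp hr hM hAc,
    fun E₀ => eigenfunctionsConverge_bsOp hr hM hA hAc⟩

end Eigenfunctions

/-! ### Scalar symbols and square roots of potentials -/

section ScalarSymbols

theorem norm_ofReal_smul_id (c : ℝ) : ‖(c : ℂ) • ContinuousLinearMap.id ℂ ℂ‖ = |c| := by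
  rw [norm_smul, ContinuousLinearMap.norm_id, mul_one, Complex.norm_real, Real.norm_eq_abs]

theorem exists_bound_annulus {E : Type*} [NormedAddCommGroup E] {f : R3 → E} (hf : Continuous f)
    (N : ℕ) : ∃ c, ∀ ξ ∈ annulus N, ‖f ξ‖ ≤ c := by
  obtain ⟨c, hc⟩ := (isCompact_closedBall (0 : R3) (2 ^ N)).exists_bound_of_continuousOn
    hf.continuousOn
  exact ⟨c, fun ξ hξ => hc ξ (by simpa using hξ.2.le)⟩

/-- For a scalar symbol `τ ≥ 0` the bound on `(τ - E)⁻¹`, `E ≤ 0`, reduces to the one at `E = 0`. -/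
theorem isResolventFamily_of_scalar {t : R3 → ℂ →L[ℂ] ℂ} {τ : R3 → ℝ}
    (ht : ∀ ξ, symbolAt t ξ = ((τ ξ : ℝ) : ℂ) • ContinuousLinearMap.id ℂ ℂ) (hτ : Continuous τ)
    (hτ0 : ∀ ξ, 0 ≤ τ ξ) {b c : ℝ} (hb : 0 ≤ b) (hc : 0 ≤ c)
    (hτw : ∀ ξ ≠ 0, 1 ≤ c * weight b ξ ^ 2 * τ ξ) :
    IsResolventFamily t b c (Set.Iio 0) (Set.Iic 0)
      (fun E ξ => (((τ ξ - E)⁻¹ : ℝ) : ℂ) • ContinuousLinearMap.id ℂ ℂ) := by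
  have hcont : Continuous (symbolAt t) := by
    rw [funext ht]
    exact (Complex.continuous_ofReal.comp hτ).smul continuous_const
  have hpos : ∀ ξ ≠ 0, 0 < τ ξ := fun ξ hξ => (hτ0 ξ).lt_of_ne fun h => by
    have := hτw ξ hξ
    rw [← h] at this
    linarith
  refine ⟨hb, hc, Set.Iio_subset_Iic_self, hcont.aestronglyMeasurable, exists_bound_annulus hcont,
    fun E _ => ?_, fun E hE ξ hξ => ?_, fun E hE => ⟨(-E)⁻¹, fun ξ => ?_⟩, fun E hE ξ v => ?_,
    fun E hE ξ v => ?_, fun E hE ξ hξ => ?_⟩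
  · exact (Complex.measurable_ofReal.comp
      (hτ.measurable.sub_const E).inv).aestronglyMeasurable.smul_const _
  · have hE : E ≤ 0 := hE
    have h1 := hpos ξ hξ
    rw [norm_ofReal_smul_id, abs_of_nonneg (inv_nonneg.2 (by linarith)),
      inv_le_iff_one_le_mul₀ (by linarith)]
    refine (hτw ξ hξ).trans ?_
    gcongr
    linarith
  · have hE : E < 0 := hE
    have h1 := hτ0 ξ
    rw [norm_ofReal_smul_id, abs_of_nonneg (inv_nonneg.2 (by linarith))]
    exact inv_anti₀ (by linarith) (by linarith)
  · have hE : E < 0 := hE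
    have h1 : (τ ξ : ℂ) - E ≠ 0 := by
      exact_mod_cast (show τ ξ - E ≠ 0 by linarith [hτ0 ξ])
    rw [ht]
    simp only [smul_apply, ContinuousLinearMap.id_apply, smul_eq_mul]
    push_cast
    rw [← sub_mul, ← mul_assoc, inv_mul_cancel₀ h1, one_mul]
  · have hE : E < 0 := hE
    have h1 : (τ ξ : ℂ) - E ≠ 0 := by
      exact_mod_cast (show τ ξ - E ≠ 0 by linarith [hτ0 ξ])
    rw [ht]
    simp only [smul_apply, ContinuousLinearMap.id_apply, smul_eq_mul]
    push_cast
    rw [← sub_mul, ← mul_assoc, mul_inv_cancel₀ h1, one_mul]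
  · have hE : E ≤ 0 := hE
    have h1 := hpos ξ hξ
    have h2 : Tendsto (fun E' => (τ ξ - E')⁻¹) (𝓝 E) (𝓝 (τ ξ - E)⁻¹) :=
      (tendsto_const_nhds.sub tendsto_id).inv₀ (by linarith)
    exact (((Complex.continuous_ofReal.tendsto _).comp
      (h2.mono_left nhdsWithin_le_nhds)).smul_const _)

theorem norm_two_pi_smul (ξ : R3) : ‖(2 * Real.pi) • ξ‖ = 2 * Real.pi * ‖ξ‖ := by
  rw [norm_smul, Real.norm_of_nonneg (by positivity)]

theorem norm_le_norm_two_pi_smul (ξ : R3) : ‖ξ‖ ≤ ‖(2 * Real.pi) • ξ‖ := by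
  rw [norm_two_pi_smul]
  nlinarith [Real.pi_gt_three, norm_nonneg ξ]

theorem weight_one (ξ : R3) : weight 1 ξ = ‖ξ‖⁻¹ := by
  unfold weight; split_ifs
  · rfl
  · rw [Real.rpow_neg_one]

theorem weight_half_sq_of_one_le {ξ : R3} (h : 1 ≤ ‖ξ‖) : weight (1 / 2) ξ ^ 2 = ‖ξ‖⁻¹ := by
  rw [weight, if_neg (by linarith), ← Real.rpow_natCast, ← Real.rpow_mul (norm_nonneg _),
    ← Real.rpow_neg_one]
  norm_num

theorem isResolventFamily_schroedinger : IsResolventFamily schroedingerSymbol 1 1 (Set.Iio 0)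
    (Set.Iic 0) (fun E ξ => (((‖(2 * Real.pi) • ξ‖ ^ 2 - E)⁻¹ : ℝ) : ℂ) •
      ContinuousLinearMap.id ℂ ℂ) := by
  refine isResolventFamily_of_scalar (τ := fun ξ => ‖(2 * Real.pi) • ξ‖ ^ 2) (fun ξ => rfl)
    (by fun_prop) (fun ξ => by positivity) zero_le_one zero_le_one fun ξ hξ => ?_
  have h1 := norm_pos_iff.2 hξ
  have h2 : ‖ξ‖ ^ 2 ≤ ‖(2 * Real.pi) • ξ‖ ^ 2 := by
    gcongr; exact norm_le_norm_two_pi_smul ξ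
  rw [weight_one, one_mul, inv_pow, ← div_eq_inv_mul, one_le_div (by positivity)]
  exact h2

/-- `√(p² + m²) - m` is comparable with `p²` for small and with `|p|` for large `p`. -/
theorem isResolventFamily_pseudorel {m : ℝ} (hm : 0 < m) :
    IsResolventFamily (pseudorelSymbol m) (1 / 2) (1 + 2 * m) (Set.Iio 0) (Set.Iic 0)
      (fun E ξ => (((√(‖(2 * Real.pi) • ξ‖ ^ 2 + m ^ 2) - m - E)⁻¹ : ℝ) : ℂ) •
        ContinuousLinearMap.id ℂ ℂ) := by
  have h0 : ∀ s : ℝ, m ≤ √(s ^ 2 + m ^ 2) := fun s =>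
    Real.le_sqrt_of_sq_le (by nlinarith [sq_nonneg s])
  refine isResolventFamily_of_scalar (τ := fun ξ => √(‖(2 * Real.pi) • ξ‖ ^ 2 + m ^ 2) - m)
    (fun ξ => rfl) (by fun_prop) (fun ξ => sub_nonneg.2 (h0 _)) (by norm_num) (by positivity)
    fun ξ hξ => ?_
  have hs := norm_pos_iff.2 hξ
  set s := ‖ξ‖ with hsdef
  set q := √(s ^ 2 + m ^ 2) with hq
  have hq2 : q ^ 2 = s ^ 2 + m ^ 2 := Real.sq_sqrt (by positivity)
  have hqm : m ≤ q := h0 s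
  have hqs : q ≤ s + m := Real.sqrt_le_iff.2 ⟨by positivity, by nlinarith⟩
  have hle : q - m ≤ √(‖(2 * Real.pi) • ξ‖ ^ 2 + m ^ 2) - m := by
    have := norm_le_norm_two_pi_smul ξ
    gcongr
    exact Real.sqrt_le_sqrt (by gcongr)
  have hmul : (q - m) * (q + m) = s ^ 2 := by ring_nf; linarith
  have key : 1 ≤ (1 + 2 * m) * weight (1 / 2) ξ ^ 2 * (q - m) := by
    rcases lt_or_ge s 1 with h | h
    · have hw : weight (1 / 2) ξ = s⁻¹ := if_pos h
      rw [hw, inv_pow, mul_assoc, ← div_eq_inv_mul, mul_div_assoc', one_le_div (by positivity),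
        ← hmul, mul_comm (1 + 2 * m)]
      exact mul_le_mul_of_nonneg_left (by linarith) (by linarith)
    · have hw : weight (1 / 2) ξ ^ 2 = s⁻¹ := weight_half_sq_of_one_le h
      rw [hw, mul_assoc, ← div_eq_inv_mul, mul_div_assoc', one_le_div (by positivity)]
      have h1 : q + m ≤ (1 + 2 * m) * s := by nlinarith
      have h2 : 0 ≤ q - m := by linarith
      have h3 := mul_le_mul_of_nonneg_left h1 h2
      rw [hmul] at h3
      nlinarith
  refine key.trans ?_
  gcongr

end ScalarSymbols

section Potentials

/-- Interpolation: `|V|^q ≤ |V|^{q₁} + |V|^{q₂}`. -/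
theorem integrable_rpow_of_memLp {E : Type*} [NormedAddCommGroup E] {V : R3 → E} {q₁ q₂ q : ℝ}
    (h0 : 0 < q₁) (h₁ : q₁ ≤ q) (h₂ : q ≤ q₂) (hV₁ : MemLp V (ENNReal.ofReal q₁) volume)
    (hV₂ : MemLp V (ENNReal.ofReal q₂) volume) : Integrable (fun x => ‖V x‖ ^ q) volume := by
  have e : ∀ q' : ℝ, 0 < q' → MemLp V (ENNReal.ofReal q') volume →
      Integrable (fun x => ‖V x‖ ^ q') volume := fun q' hq' hV => by
    have := hV.integrable_norm_rpow (by simpa using hq') ENNReal.ofReal_ne_top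
    rwa [ENNReal.toReal_ofReal hq'.le] at this
  refine ((e q₁ h0 hV₁).add (e q₂ (by linarith) hV₂)).mono'
    (hV₁.1.norm.aemeasurable.pow_const q).aestronglyMeasurable (Eventually.of_forall fun x => ?_)
  rw [Real.norm_of_nonneg (by positivity), Pi.add_apply]
  have hx := norm_nonneg (V x)
  rcases le_total ‖V x‖ 1 with h | h
  · rcases hx.eq_or_lt with h' | h'
    · rw [← h', Real.zero_rpow (by linarith), Real.zero_rpow (by linarith),
        Real.zero_rpow (by linarith)]
      simp
    · exact (Real.rpow_le_rpow_of_exponent_ge h' h h₁).trans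
        (le_add_of_nonneg_right (by positivity))
  · exact (Real.rpow_le_rpow_of_exponent_le h h₂).trans (le_add_of_nonneg_left (by positivity))

theorem integrable_norm_rpow_of_sqrt {E F : Type*} [NormedAddCommGroup E] [NormedAddCommGroup F]
    {V : R3 → E} {W : R3 → F} (hW : AEStronglyMeasurable W volume) (hWV : ∀ x, ‖W x‖ ≤ √‖V x‖)
    {p : ℝ} (hp : 0 ≤ p) (hV : Integrable (fun x => ‖V x‖ ^ (p / 2)) volume) :
    Integrable (fun x => ‖W x‖ ^ p) volume := by
  refine hV.mono' (hW.norm.aemeasurable.pow_const p).aestronglyMeasurable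
    (Eventually.of_forall fun x => ?_)
  rw [Real.norm_of_nonneg (by positivity)]
  refine (Real.rpow_le_rpow (norm_nonneg _) (hWV x) hp).trans (le_of_eq ?_)
  rw [Real.sqrt_eq_rpow, ← Real.rpow_mul (norm_nonneg _)]
  ring_nf

theorem norm_scalarSqrt_le (V : R3 → ℝ) (x : R3) : ‖scalarSqrt V x‖ ≤ √‖V x‖ := by
  rw [scalarSqrt, norm_ofReal_smul_id, abs_of_nonneg (Real.sqrt_nonneg _)]
  exact Real.sqrt_le_sqrt (le_abs_self _)

theorem aestronglyMeasurable_scalarSqrt {V : R3 → ℝ} (hV : AEStronglyMeasurable V volume) :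
    AEStronglyMeasurable (scalarSqrt V) volume :=
  ((Complex.continuous_ofReal.comp Real.continuous_sqrt).comp_aestronglyMeasurable hV).smul_const _

theorem inner_scalarSqrt (V : R3 → ℝ) (x : R3) (y z : ℂ) :
    inner ℂ (scalarSqrt V x y) z = inner ℂ y (scalarSqrt V x z) := by
  simp [scalarSqrt]
  ring

open scoped Matrix.Norms.L2Operator in
theorem norm_diagonalSqrt_le (V : R3 → EuclideanSpace ℝ (Fin 4)) (x : R3) :
    ‖diagonalSqrt V x‖ ≤ √‖V x‖ := by
  rw [diagonalSqrt, ← Matrix.cstar_norm_def, Matrix.l2_opNorm_diagonal,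
    pi_norm_le_iff_of_nonneg (Real.sqrt_nonneg _)]
  intro i
  rw [Complex.norm_real, Real.norm_of_nonneg (Real.sqrt_nonneg _)]
  exact Real.sqrt_le_sqrt ((le_abs_self _).trans (PiLp.norm_apply_le (V x) i))

theorem continuous_toEuclideanCLM : Continuous fun A : Matrix (Fin 4) (Fin 4) ℂ =>
    (Matrix.toEuclideanCLM (𝕜 := ℂ) (n := Fin 4) A : C4 →L[ℂ] C4) :=
  LinearMap.continuous_of_finiteDimensional
    (Matrix.toEuclideanCLM (𝕜 := ℂ) (n := Fin 4)).toAlgEquiv.toLinearMap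

theorem aestronglyMeasurable_diagonalSqrt {V : R3 → EuclideanSpace ℝ (Fin 4)}
    (hV : AEStronglyMeasurable V volume) : AEStronglyMeasurable (diagonalSqrt V) volume := by
  have h : Continuous fun v : EuclideanSpace ℝ (Fin 4) =>
      (Matrix.diagonal fun i => ((√(v i) : ℝ) : ℂ) : Matrix (Fin 4) (Fin 4) ℂ) := by
    refine Continuous.matrix_diagonal (continuous_pi fun i => ?_)
    fun_prop
  exact (continuous_toEuclideanCLM.comp h).comp_aestronglyMeasurable hV

theorem inner_diagonalSqrt (V : R3 → EuclideanSpace ℝ (Fin 4)) (x : R3) (y z : C4) :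
    inner ℂ (diagonalSqrt V x y) z = inner ℂ y (diagonalSqrt V x z) := by
  simp only [diagonalSqrt, PiLp.inner_apply, Matrix.ofLp_toEuclideanCLM, Matrix.mulVec_diagonal]
  refine Finset.sum_congr rfl fun i _ => ?_
  simp
  ring

end Potentials

/-! ### The Dirac operator -/

section Dirac

/-- The matrix `α·p + mβ`. -/
def diracMatrix (m : ℝ) (p : R3) : Matrix (Fin 4) (Fin 4) ℂ :=
  (∑ j, ((p j : ℝ) : ℂ) • diracAlpha j) + (m : ℂ) • diracBeta

theorem diracMatrix_eq (m : ℝ) (p : R3) : diracMatrix m p =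
    !![(m : ℂ), 0, p 2, p 0 - p 1 * Complex.I; 0, m, p 0 + p 1 * Complex.I, -p 2;
      p 2, p 0 - p 1 * Complex.I, -m, 0; p 0 + p 1 * Complex.I, -p 2, 0, -m] := by
  ext i j
  simp only [diracMatrix, Fin.sum_univ_three, Matrix.add_apply, Matrix.smul_apply, diracBeta,
    Matrix.diagonal_apply]
  fin_cases i <;> fin_cases j <;> simp [diracAlpha, sub_eq_add_neg]

/-- The Dirac matrices anticommute and have square `1`. -/
theorem diracMatrix_mul_self (m : ℝ) (p : R3) :
    diracMatrix m p * diracMatrix m p = ((‖p‖ ^ 2 + m ^ 2 : ℝ) : ℂ) • 1 := by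
  have hI : Complex.I ^ 2 = -1 := Complex.I_sq
  rw [EuclideanSpace.real_norm_sq_eq, Fin.sum_univ_three, diracMatrix_eq]
  ext i j
  rw [Matrix.mul_apply, Fin.sum_univ_four, Matrix.smul_apply, Matrix.one_apply]
  fin_cases i <;> fin_cases j <;> simp <;>
    first | ring1 | linear_combination (-(p 1 : ℂ) ^ 2) * hI

theorem exists_norm_map_diracMatrix_le {E : Type*} [NormedAddCommGroup E] [NormedSpace ℂ E]
    (T : Matrix (Fin 4) (Fin 4) ℂ →ₗ[ℂ] E) : ∃ c : ℝ, 0 ≤ c ∧ ∀ (m : ℝ) (p : R3),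
      ‖T (diracMatrix m p)‖ ≤ c * (‖p‖ + |m|) := by
  refine ⟨(∑ j, ‖T (diracAlpha j)‖) + ‖T diracBeta‖, by positivity, fun m p => ?_⟩
  rw [diracMatrix, map_add, map_sum, map_smul]
  simp only [map_smul]
  refine (norm_add_le _ _).trans ?_
  have h1 : ‖∑ j, ((p j : ℝ) : ℂ) • T (diracAlpha j)‖ ≤ (∑ j, ‖T (diracAlpha j)‖) * ‖p‖ := by
    refine (norm_sum_le _ _).trans ?_
    rw [Finset.sum_mul]
    refine Finset.sum_le_sum fun j _ => ?_
    rw [norm_smul, Complex.norm_real, mul_comm]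
    gcongr
    exact PiLp.norm_apply_le p j
  have h2 : ‖(m : ℂ) • T diracBeta‖ = ‖T diracBeta‖ * |m| := by
    rw [norm_smul, Complex.norm_real, mul_comm, Real.norm_eq_abs]
  have h3 : 0 ≤ ∑ j, ‖T (diracAlpha j)‖ := by positivity
  rw [h2]
  nlinarith [norm_nonneg p, abs_nonneg m, norm_nonneg (T diracBeta), mul_nonneg h3 (abs_nonneg m),
    mul_nonneg (norm_nonneg (T diracBeta)) (norm_nonneg p)]

theorem exists_norm_toEuclideanCLM_diracMatrix_le : ∃ c : ℝ, 0 ≤ c ∧ ∀ (m : ℝ) (p : R3),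
    ‖(Matrix.toEuclideanCLM (𝕜 := ℂ) (n := Fin 4) (diracMatrix m p) : C4 →L[ℂ] C4)‖ ≤
      c * (‖p‖ + |m|) :=
  exists_norm_map_diracMatrix_le
    (Matrix.toEuclideanCLM (𝕜 := ℂ) (n := Fin 4)).toAlgEquiv.toLinearMap

theorem diracSymbol_apply (m : ℝ) (p : R3) (v : C4) : diracSymbol m p v =
    Matrix.toEuclideanCLM (𝕜 := ℂ) (n := Fin 4) (diracMatrix m p) v - (m : ℂ) • v := by
  rw [diracSymbol, map_sub, map_smul, map_one]
  rfl

/-- The resolvent of the Dirac operator at `E = z - m`, by rationalization: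
`(α·p + mβ - z)⁻¹ = (α·p + mβ + z) / (p² + m² - z²)`. -/
def diracResolvent (m E : ℝ) (ξ : R3) : C4 →L[ℂ] C4 :=
  (((‖(2 * Real.pi) • ξ‖ ^ 2 + m ^ 2 - (E + m) ^ 2)⁻¹ : ℝ) : ℂ) •
    (Matrix.toEuclideanCLM (𝕜 := ℂ) (n := Fin 4) (diracMatrix m ((2 * Real.pi) • ξ)) +
      ((E + m : ℝ) : ℂ) • ContinuousLinearMap.id ℂ C4)

theorem continuous_toEuclideanCLM_diracMatrix (m : ℝ) : Continuous fun ξ : R3 =>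
    (Matrix.toEuclideanCLM (𝕜 := ℂ) (n := Fin 4) (diracMatrix m ((2 * Real.pi) • ξ)) :
      C4 →L[ℂ] C4) := by
  refine continuous_toEuclideanCLM.comp ?_
  unfold diracMatrix
  refine Continuous.add (continuous_finsetSum _ fun j _ => ?_) continuous_const
  refine Continuous.smul (Complex.continuous_ofReal.comp ?_) continuous_const
  fun_prop

theorem toEuclideanCLM_diracMatrix_apply_apply (m : ℝ) (p : R3) (v : C4) :
    Matrix.toEuclideanCLM (𝕜 := ℂ) (n := Fin 4) (diracMatrix m p)
      (Matrix.toEuclideanCLM (𝕜 := ℂ) (n := Fin 4) (diracMatrix m p) v) =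
      ((‖p‖ ^ 2 + m ^ 2 : ℝ) : ℂ) • v := by
  rw [← mul_apply_eq_comp, ← map_mul, diracMatrix_mul_self, map_smul, map_one]
  rfl

/-- The numerator of the rationalized resolvent is bounded by a constant times `|p| + m`, and its
denominator is at least `p²` for all energies in the closed gap. -/
theorem exists_isResolventFamily_dirac {m : ℝ} (hm : 0 < m) : ∃ C,
    IsResolventFamily (diracSymbol m) (1 / 2) C (Set.Ioo (-2 * m) 0) (Set.Icc (-2 * m) 0)
      (diracResolvent m) := by
  obtain ⟨c, hc, hcb⟩ := exists_norm_toEuclideanCLM_diracMatrix_le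
  have hcont := continuous_toEuclideanCLM_diracMatrix m
  have hsymb : Continuous (symbolAt (diracSymbol m)) := by
    have : symbolAt (diracSymbol m) = fun ξ =>
        (Matrix.toEuclideanCLM (𝕜 := ℂ) (n := Fin 4) (diracMatrix m ((2 * Real.pi) • ξ)) :
          C4 →L[ℂ] C4) - (m : ℂ) • ContinuousLinearMap.id ℂ C4 := by
      ext1 ξ
      ext1 v
      rw [symbolAt, diracSymbol_apply]
      rfl
    rw [this]
    exact hcont.sub continuous_const
  have hz : ∀ E ∈ Set.Icc (-2 * m) 0, |E + m| ≤ m := fun E hE =>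
    abs_le.2 ⟨by linarith [hE.1], by linarith [hE.2]⟩
  have hz2 : ∀ E ∈ Set.Icc (-2 * m) 0, 0 ≤ m ^ 2 - (E + m) ^ 2 := fun E hE =>
    sub_nonneg.2 (sq_le_sq.2 (by rw [abs_of_pos hm]; exact hz E hE))
  have hz2' : ∀ E ∈ Set.Ioo (-2 * m) 0, 0 < m ^ 2 - (E + m) ^ 2 := fun E hE =>
    by nlinarith [hE.1, hE.2, mul_pos (neg_pos.2 hE.2) (by linarith [hE.1] : 0 < E + 2 * m)]
  -- the numerator
  have hnum : ∀ E ∈ Set.Icc (-2 * m) 0, ∀ ξ : R3,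
      ‖(Matrix.toEuclideanCLM (𝕜 := ℂ) (n := Fin 4) (diracMatrix m ((2 * Real.pi) • ξ)) :
        C4 →L[ℂ] C4) + ((E + m : ℝ) : ℂ) • ContinuousLinearMap.id ℂ C4‖ ≤
      c * ‖(2 * Real.pi) • ξ‖ + (c + 1) * m := fun E hE ξ => by
    refine (norm_add_le _ _).trans ?_
    have h1 := hcb m ((2 * Real.pi) • ξ)
    have h2 : ‖((E + m : ℝ) : ℂ) • ContinuousLinearMap.id ℂ C4‖ ≤ m := by
      rw [norm_smul, Complex.norm_real, Real.norm_eq_abs]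
      exact (mul_le_of_le_one_right (abs_nonneg _) ContinuousLinearMap.norm_id_le).trans (hz E hE)
    rw [abs_of_pos hm] at h1
    linarith
  have hnorm : ∀ E ∈ Set.Icc (-2 * m) 0, ∀ ξ : R3, ‖diracResolvent m E ξ‖ ≤
      (‖(2 * Real.pi) • ξ‖ ^ 2 + (m ^ 2 - (E + m) ^ 2))⁻¹ *
        (c * ‖(2 * Real.pi) • ξ‖ + (c + 1) * m) := fun E hE ξ => by
    have h1 := hz2 E hE
    rw [diracResolvent, norm_smul, Complex.norm_real, add_sub_assoc,
      Real.norm_of_nonneg (by positivity)]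
    gcongr
    exact hnum E hE ξ
  refine ⟨7 * c + (c + 1) * m, by norm_num, by positivity, Set.Ioo_subset_Icc_self,
    hsymb.aestronglyMeasurable, exists_bound_annulus hsymb, fun E _ => ?_, fun E hE ξ hξ => ?_,
    fun E hE => ⟨(c + (c + 1) * m) * (1 + (m ^ 2 - (E + m) ^ 2)⁻¹), fun ξ => ?_⟩,
    fun E hE ξ v => ?_, fun E hE ξ v => ?_, fun E hE ξ hξ => ?_⟩
  · have h1 : Measurable fun ξ : R3 =>
        (((‖(2 * Real.pi) • ξ‖ ^ 2 + m ^ 2 - (E + m) ^ 2)⁻¹ : ℝ) : ℂ) := by fun_prop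
    exact h1.aestronglyMeasurable.smul (hcont.add continuous_const).aestronglyMeasurable
  · have hs := norm_pos_iff.2 hξ
    have h1 := hz2 E hE
    have hle := norm_le_norm_two_pi_smul ξ
    have hle' : ‖(2 * Real.pi) • ξ‖ ≤ 7 * ‖ξ‖ := by
      rw [norm_two_pi_smul]
      gcongr
      linarith [Real.pi_lt_d2]
    refine (hnorm E hE ξ).trans ?_
    have h2 : (‖(2 * Real.pi) • ξ‖ ^ 2 + (m ^ 2 - (E + m) ^ 2))⁻¹ *
        (c * ‖(2 * Real.pi) • ξ‖ + (c + 1) * m) ≤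
        (‖ξ‖ ^ 2)⁻¹ * (c * (7 * ‖ξ‖) + (c + 1) * m) := by
      gcongr
      nlinarith
    refine h2.trans ?_
    have hcm : 0 ≤ (c + 1) * m := by positivity
    rw [inv_mul_le_iff₀ (by positivity)]
    rcases lt_or_ge ‖ξ‖ 1 with h | h
    · have hw : weight (1 / 2) ξ = ‖ξ‖⁻¹ := if_pos h
      rw [hw, show ‖ξ‖ ^ 2 * ((7 * c + (c + 1) * m) * ‖ξ‖⁻¹ ^ 2) = 7 * c + (c + 1) * m by
        field_simp]
      nlinarith
    · rw [weight_half_sq_of_one_le h, show ‖ξ‖ ^ 2 * ((7 * c + (c + 1) * m) * ‖ξ‖⁻¹) =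
        (7 * c + (c + 1) * m) * ‖ξ‖ by field_simp]
      nlinarith
  · have h1 := hz2' E hE
    have hcm : 0 ≤ (c + 1) * m := by positivity
    refine (hnorm E (Set.Ioo_subset_Icc_self hE) ξ).trans ?_
    set d := m ^ 2 - (E + m) ^ 2 with hd
    set s := ‖(2 * Real.pi) • ξ‖ with hs
    have hs0 : 0 ≤ s := norm_nonneg _
    rw [inv_mul_le_iff₀ (by positivity), show (s ^ 2 + d) * ((c + (c + 1) * m) * (1 + d⁻¹)) =
      (c + (c + 1) * m) * (s ^ 2 + d + s ^ 2 * d⁻¹ + 1) by field_simp; ring]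
    have h3 : 0 ≤ s ^ 2 * d⁻¹ := by positivity
    have h4 : s ≤ s ^ 2 + d + s ^ 2 * d⁻¹ + 1 := by nlinarith [sq_nonneg (s - 1)]
    have h5 : 1 ≤ s ^ 2 + d + s ^ 2 * d⁻¹ + 1 := by nlinarith [sq_nonneg s]
    nlinarith [mul_le_mul_of_nonneg_left h4 hc, mul_le_mul_of_nonneg_left h5 hcm]
  · have h1 : (((‖(2 * Real.pi) • ξ‖ ^ 2 + m ^ 2 - (E + m) ^ 2 : ℝ)) : ℂ) ≠ 0 := by
      have := hz2' E hE
      exact_mod_cast (by nlinarith [sq_nonneg ‖(2 * Real.pi) • ξ‖])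
    rw [symbolAt, diracSymbol_apply, diracResolvent, Complex.ofReal_inv, smul_apply,
      inv_smul_eq_iff₀ h1]
    simp only [add_apply, smul_apply, ContinuousLinearMap.id_apply, map_sub, map_smul,
      toEuclideanCLM_diracMatrix_apply_apply]
    push_cast
    module
  · have h1 : (((‖(2 * Real.pi) • ξ‖ ^ 2 + m ^ 2 - (E + m) ^ 2 : ℝ)) : ℂ) ≠ 0 := by
      have := hz2' E hE
      exact_mod_cast (by nlinarith [sq_nonneg ‖(2 * Real.pi) • ξ‖])
    rw [symbolAt, diracSymbol_apply, diracResolvent, Complex.ofReal_inv, smul_apply, map_smul,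
      smul_comm (m : ℂ), smul_comm (E : ℂ), ← smul_sub, ← smul_sub, inv_smul_eq_iff₀ h1]
    simp only [add_apply, smul_apply, ContinuousLinearMap.id_apply, map_add, map_smul,
      toEuclideanCLM_diracMatrix_apply_apply]
    push_cast
    module
  · have h1 : ‖(2 * Real.pi) • ξ‖ ^ 2 + m ^ 2 - (E + m) ^ 2 ≠ 0 := by
      have h2 := norm_le_norm_two_pi_smul ξ
      have h3 := norm_pos_iff.2 hξ
      have h4 := hz2 E hE
      nlinarith
    refine Tendsto.mono_left ?_ nhdsWithin_le_nhds
    have hE : Tendsto (fun E' : ℝ => E' + m) (𝓝 E) (𝓝 (E + m)) := tendsto_id.add_const m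
    refine Tendsto.smul ((Complex.continuous_ofReal.tendsto _).comp
      ((tendsto_const_nhds.sub (hE.pow 2)).inv₀ h1)) (tendsto_const_nhds.add ?_)
    exact ((Complex.continuous_ofReal.tendsto _).comp hE).smul_const _

end Dirac

theorem lemma5p1 (m : ℝ) (hm : 0 < m) (ε : ℝ) (hε : 0 < ε) (hε' : ε < 3 / 2) :
    -- Schrödinger case
    (∀ V : R3 → ℝ, (∀ᵐ x ∂volume, 0 ≤ V x) →
      MemLp V (ENNReal.ofReal (3 / 2 + ε)) volume →
      MemLp V (ENNReal.ofReal (3 / 2 - ε)) volume →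
      ∃ (K : ℝ → L2 ℂ →L[ℂ] L2 ℂ) (K₀ : L2 ℂ →L[ℂ] L2 ℂ),
        (∀ E < 0, IsBirmanSchwinger schroedingerSymbol (scalarSqrt V) E (K E)) ∧
        (∀ E < 0, IsCompactOperator (K E)) ∧
        Tendsto K (𝓝[<] 0) (𝓝 K₀) ∧
        IsCompactOperator K₀ ∧
        EigenfunctionsConverge schroedingerSymbol (scalarSqrt V) (Set.Iio 0) 0 K₀) ∧
    -- pseudorelativistic case
    (∀ V : R3 → ℝ, (∀ᵐ x ∂volume, 0 ≤ V x) →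
      MemLp V (ENNReal.ofReal (3 + ε)) volume →
      MemLp V (ENNReal.ofReal (3 / 2 - ε)) volume →
      ∃ (K : ℝ → L2 ℂ →L[ℂ] L2 ℂ) (K₀ : L2 ℂ →L[ℂ] L2 ℂ),
        (∀ E < 0, IsBirmanSchwinger (pseudorelSymbol m) (scalarSqrt V) E (K E)) ∧
        (∀ E < 0, IsCompactOperator (K E)) ∧
        Tendsto K (𝓝[<] 0) (𝓝 K₀) ∧
        IsCompactOperator K₀ ∧
        EigenfunctionsConverge (pseudorelSymbol m) (scalarSqrt V) (Set.Iio 0) 0 K₀) ∧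
    -- Dirac case, at both thresholds
    (∀ V : R3 → EuclideanSpace ℝ (Fin 4), (∀ᵐ x ∂volume, ∀ i, 0 ≤ V x i) →
      MemLp V (ENNReal.ofReal (3 + ε)) volume →
      MemLp V (ENNReal.ofReal (3 / 2 - ε)) volume →
      ∃ (K : ℝ → L2 C4 →L[ℂ] L2 C4) (K₀ K₂ₘ : L2 C4 →L[ℂ] L2 C4),
        (∀ E ∈ Set.Ioo (-2 * m) 0,
          IsBirmanSchwinger (diracSymbol m) (diagonalSqrt V) E (K E)) ∧
        (∀ E ∈ Set.Ioo (-2 * m) 0, IsCompactOperator (K E)) ∧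
        Tendsto K (𝓝[<] 0) (𝓝 K₀) ∧
        Tendsto K (𝓝[>] (-2 * m)) (𝓝 K₂ₘ) ∧
        IsCompactOperator K₀ ∧
        IsCompactOperator K₂ₘ ∧
        EigenfunctionsConverge (diracSymbol m) (diagonalSqrt V) (Set.Ioo (-2 * m) 0) 0 K₀ ∧
        EigenfunctionsConverge (diracSymbol m) (diagonalSqrt V) (Set.Ioo (-2 * m) 0)
          (-2 * m) K₂ₘ) := by
  -- shrinking the gap between the exponents keeps `p₁ = 3 - 2δ` above `2`
  obtain ⟨δ, hδ, hδε, hδ4⟩ : ∃ δ : ℝ, 0 < δ ∧ δ ≤ ε ∧ δ ≤ 1 / 4 :=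
    ⟨min ε (1 / 4), by positivity, min_le_left _ _, min_le_right _ _⟩
  have hε0 : 0 < 3 / 2 - ε := by linarith
  refine ⟨fun V _ hV₁ hV₂ => ?_, fun V _ hV₁ hV₂ => ?_, fun V _ hV₁ hV₂ => ?_⟩
  · have hW := aestronglyMeasurable_scalarSqrt hV₁.1
    have hWp : ∀ p, 3 / 2 - ε ≤ p / 2 → p / 2 ≤ 3 / 2 + ε →
        Integrable (fun x => ‖scalarSqrt V x‖ ^ p) volume := fun p h1 h2 =>
      integrable_norm_rpow_of_sqrt hW (norm_scalarSqrt_le V) (by linarith)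
        (integrable_rpow_of_memLp hε0 h1 h2 hV₂ hV₁)
    obtain ⟨K, hK, hKc, hKt, hKe⟩ := exists_birmanSchwinger_family isResolventFamily_schroedinger hW
      (Eventually.of_forall (inner_scalarSqrt V)) (p₁ := 3 - 2 * δ) (p₂ := 3 + 2 * δ) (by linarith)
      (by linarith) (by linarith) (by linarith) (hWp _ (by linarith) (by linarith))
      (hWp _ (by linarith) (by linarith))
    exact ⟨K, K 0, hK, fun E _ => hKc E,
      (hKt 0 (Set.mem_Iic.2 le_rfl)).mono_left (nhdsWithin_mono _ Set.Iio_subset_Iic_self), hKc 0,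
      hKe 0 (Set.mem_Iic.2 le_rfl)⟩
  · have hW := aestronglyMeasurable_scalarSqrt hV₁.1
    have hWp : ∀ p, 3 / 2 - ε ≤ p / 2 → p / 2 ≤ 3 + ε →
        Integrable (fun x => ‖scalarSqrt V x‖ ^ p) volume := fun p h1 h2 =>
      integrable_norm_rpow_of_sqrt hW (norm_scalarSqrt_le V) (by linarith)
        (integrable_rpow_of_memLp hε0 h1 h2 hV₂ hV₁)
    obtain ⟨K, hK, hKc, hKt, hKe⟩ := exists_birmanSchwinger_family (isResolventFamily_pseudorel hm)
      hW (Eventually.of_forall (inner_scalarSqrt V)) (p₁ := 3 - 2 * δ) (p₂ := 6 + 2 * δ)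
      (by linarith) (by linarith) (by linarith) (by linarith) (hWp _ (by linarith) (by linarith))
      (hWp _ (by linarith) (by linarith))
    exact ⟨K, K 0, hK, fun E _ => hKc E,
      (hKt 0 (Set.mem_Iic.2 le_rfl)).mono_left (nhdsWithin_mono _ Set.Iio_subset_Iic_self), hKc 0,
      hKe 0 (Set.mem_Iic.2 le_rfl)⟩
  · have hW := aestronglyMeasurable_diagonalSqrt hV₁.1
    have hWp : ∀ p, 3 / 2 - ε ≤ p / 2 → p / 2 ≤ 3 + ε →
        Integrable (fun x => ‖diagonalSqrt V x‖ ^ p) volume := fun p h1 h2 =>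
      integrable_norm_rpow_of_sqrt hW (norm_diagonalSqrt_le V) (by linarith)
        (integrable_rpow_of_memLp hε0 h1 h2 hV₂ hV₁)
    obtain ⟨C, hC⟩ := exists_isResolventFamily_dirac hm
    obtain ⟨K, hK, hKc, hKt, hKe⟩ := exists_birmanSchwinger_family hC
      hW (Eventually.of_forall (inner_diagonalSqrt V)) (p₁ := 3 - 2 * δ) (p₂ := 6 + 2 * δ)
      (by linarith) (by linarith) (by linarith) (by linarith) (hWp _ (by linarith) (by linarith))
      (hWp _ (by linarith) (by linarith))
    have hm' : -2 * m < 0 := by linarith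
    have h0 : (0 : ℝ) ∈ Set.Icc (-2 * m) 0 := Set.right_mem_Icc.2 hm'.le
    have h2m : -2 * m ∈ Set.Icc (-2 * m) 0 := Set.left_mem_Icc.2 hm'.le
    exact ⟨K, K 0, K (-2 * m), hK, fun E _ => hKc E,
      (hKt 0 h0).mono_left (nhdsWithin_le_of_mem (Icc_mem_nhdsLT hm')),
      (hKt _ h2m).mono_left (nhdsWithin_le_of_mem (Icc_mem_nhdsGT hm')), hKc 0, hKc _,
      hKe 0 h0, hKe _ h2m⟩

end
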